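/- Let $d\in\{2,3\}$ and let $\Omega\subset\mathbb R^d$ be a bounded domain (nonempty, open, connected) with Lipschitz boundary. For $\kappa\ge 1$ and a real vector field $A\in L^\infty(\Omega,\mathbb R^d)$ consider on $H^1(\Omega)=H^1(\Omega;\mathbb C)$ the Ginzburg--Landau energy $$E(v)=\tfrac12\int_\Omega \big|\tfrac{i}{\kappa}\nabla v+Av\big|^2+\tfrac12(|v|^2-1)^2\,dx .$$ With $(v,w)_{L^2}:=\operatorname{Re}\int_\Omega v\overline w\,dx$, its first two derivatives are $$\langle E'(v),w\rangle=(\tfrac{i}{\kappa}\nabla v+Av,\tfrac{i}{\kappa}\nabla w+Aw)_{L^2}+((|v|^2-1)v,w)_{L^2},$$ $$\langle E''(v)z,w\rangle=(\tfrac{i}{\kappa}\nabla z+Az,\tfrac{i}{\kappa}\nabla w+Aw)_{L^2}+((2|v|^2-1)z+v^2\overline z,w)_{L^2}.$$ Let $\|v\|_{H^1_\kappa}:=\|v\|_{L^2(\Omega)}+\kappa^{-1}\|\nabla v\|_{L^2(\Omega)}$ and $(iu)^\perp:=\{v\in H^1(\Omega): (iu,v)_{L^2}=0\}$. Let $\mathcal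 T_h$ be a finite partition of $\Omega$ into curved simplices: the elements $K=F_K(\widehat K)$ are images of the closed reference simplex $\widehat K$ under bi-Lipschitz maps $F_K$, their union is $\overline\Omega$, and distinct elements have disjoint interiors. For $p\ge1$ let $V_h:=\{v_h\in H^1(\Omega): v_h|_K\circ F_K\in\mathbb P_p(\widehat K)\ \forall K\in\mathcal T_h\}$, where $\mathbb P_p(\widehat K)$ denotes the complex polynomials of total degree at most $p$. Let $u\in H^1(\Omega)$ be a local minimizer of $E$ (in the $H^1$-topology) with $E'(u)=0$ and $\langle E''(u)v,v\rangle>0$ for all $v\in(iu)^\perp\setminus\{0\}$. Put $$\rho(\kappa):=\sup_{v\in(iu)^\perp\setminus\{0\}}\frac{\|v\|_{H^1_\kappa}^2}{\langle E''(u)v,v\rangle},\qquad \eta_h:=\sup_{f\in L^2(\Omega),\ \|f\|_{L^2}=1}\ \inf_{v_h\in V_h\cap(iu)^\perp}\|E''(u)|_{(iu)^\perp}^{-1}f-v_h\|_{H^1_\kappa}$$ (suprema in $[0,\infty]$), where $z=E''(u)|_{(iu)^\perp}^{-1}f$ is the element of $(iu)^\perp$ with $\langle E''(u)z,v\rangle=(f,v)_{L^2}$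 for all $v\in(iu)^\perp$. Let $R_h(u)\in V_h\cap(iu)^\perp$ be the Ritz projection of $u$, defined by $\langle E''(u)R_h(u),v_h\rangle=\langle E''(u)u,v_h\rangle$ for all $v_h\in V_h\cap(iu)^\perp$. **Claim.** For every $a\ge 0$ there are constants $\eta_\star>0$ and $C>0$, depending only on $\Omega$ and $a$ (in particular not on $\kappa$, on $A$ otherwise, on the mesh, on $p$, on $u$ or on $u_h$), such that the following holds whenever $\kappa\ge1$, $\|A\|_{L^\infty(\Omega)}\le a$ and $\mathcal T_h$, $p$, $u$ are as above. If $u_h\in V_h\cap(iu)^\perp$ is any discrete critical point, i.e. $\langle E'(u_h),v_h\rangle=0$ for all $v_h\in V_h$, and if $\eta_h\le\eta_\star$, then $R_h(u)$ exists, is unique, and satisfies $$\|R_h(u)-u_h\|_{H^1_\kappa}\le C\,\rho(\kappa)\Big(\kappa^{d/4}\|u-u_h\|_{L^4(\Omega)}+\kappa^{d/2}\|u-u_h\|_{L^4(\Omega)}^2\Big)\|u-u_h\|_{H^1_\kappa}.$$ -/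

import Mathlib

open MeasureTheory Set
open scoped ENNReal NNReal ContDiff ComplexConjugate

noncomputable section

namespace GinzburgLandau

/-- Euclidean space `ℝ^d`. -/
abbrev E (d : ℕ) : Type := EuclideanSpace ℝ (Fin d)

/-- Bounded domain (open, connected, nonempty set) with Lipschitz boundary: near every boundary
point the set is, in suitable orthogonal coordinates, the strict epigraph of a Lipschitz
function. Here `n` is the direction of the vertical axis, and the graph function is evaluated at
the projection `y - ⟪n, y⟫ n` of `y` onto the hyperplane orthogonal to `n`. -/
structure IsLipschitzDomain {d : ℕ} (Ω : Set (E d)) : Prop where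
  isOpen : IsOpen Ω
  isConnected : IsConnected Ω
  isBounded : Bornology.IsBounded Ω
  lipschitz_boundary : ∀ x ∈ frontier Ω, ∃ (n : E d) (r : ℝ) (L : ℝ≥0) (γ : E d → ℝ),
    ‖n‖ = 1 ∧ 0 < r ∧ LipschitzWith L γ ∧
      ∀ y ∈ Metric.ball x r, (y ∈ Ω ↔ γ (y - inner ℝ n y • n) < inner ℝ n y)

/-- The space `L²(Ω)` of complex-valued functions. -/
abbrev L2 {d : ℕ} (Ω : Set (E d)) : Type := Lp ℂ 2 (volume.restrict Ω)

/-- The space `L²(Ω; ℂ^d)`. -/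
abbrev L2Vec {d : ℕ} (Ω : Set (E d)) : Type :=
  Lp (EuclideanSpace ℂ (Fin d)) 2 (volume.restrict Ω)

/-- The real inner product `Re ∫_Ω v conj(w)` on `L²(Ω)`. -/
def l2Inner {d : ℕ} {Ω : Set (E d)} (v w : L2 Ω) : ℝ :=
  (∫ x in Ω, v x * conj (w x)).re

/-- `g` is the weak gradient of `v` in `Ω`. -/
def IsWeakGrad {d : ℕ} (Ω : Set (E d)) (v : E d → ℂ) (g : E d → EuclideanSpace ℂ (Fin d)) :
    Prop :=
  ∀ φ : E d → ℝ, ContDiff ℝ ∞ φ → HasCompactSupport φ → tsupport φ ⊆ Ω → ∀ i : Fin d,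
    ∫ x in Ω, ((fderiv ℝ φ x (EuclideanSpace.single i 1) : ℝ) : ℂ) * v x =
      - ∫ x in Ω, (φ x : ℂ) * g x i

theorem integrable_mul_of_test {d : ℕ} (Ω : Set (E d)) {φ : E d → ℝ} (hφ : Continuous φ)
    (hc : HasCompactSupport φ) {v : E d → ℂ} (hv : MemLp v 2 (volume.restrict Ω)) :
    Integrable (fun x => (φ x : ℂ) * v x) (volume.restrict Ω) := by
  have h1 : MemLp (fun x => (φ x : ℂ)) 2 (volume.restrict Ω) :=
    Continuous.memLp_of_hasCompactSupport (Complex.continuous_ofReal.comp hφ)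
      (hc.comp_left (g := fun t : ℝ => (t : ℂ)) Complex.ofReal_zero)
  exact h1.integrable_mul hv

theorem continuous_partial {d : ℕ} {φ : E d → ℝ} (hφ : ContDiff ℝ ∞ φ) (e : E d) :
    Continuous (fun x => fderiv ℝ φ x e) :=
  (hφ.continuous_fderiv (by simp)).clm_apply continuous_const

theorem hasCompactSupport_partial {d : ℕ} {φ : E d → ℝ} (hc : HasCompactSupport φ) (e : E d) :
    HasCompactSupport (fun x => fderiv ℝ φ x e) :=
  hc.fderiv_apply (𝕜 := ℝ) e

theorem memLp_coord {d : ℕ} {Ω : Set (E d)} (g : L2Vec Ω) (i : Fin d) :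
    MemLp (fun x => g x i) 2 (volume.restrict Ω) :=
  (EuclideanSpace.proj (𝕜 := ℂ) i).comp_memLp' (Lp.memLp g)

/-- The Sobolev space `H¹(Ω)` of complex-valued functions, as a real Hilbert space: pairs of an
`L²`-function and its weak gradient in `L²`, with norm
`(‖v‖_{L²}² + ‖∇v‖_{L²}²)^{1/2}`. -/
def H1 {d : ℕ} (Ω : Set (E d)) : Submodule ℝ (WithLp 2 (L2 Ω × L2Vec Ω)) where
  carrier := {w | IsWeakGrad Ω w.fst w.snd}
  zero_mem' := by
    intro φ _ _ _ i
    have h1 : ∫ x in Ω, ((fderiv ℝ φ x (EuclideanSpace.single i 1) : ℝ) : ℂ) * (0 : L2 Ω) x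
        = 0 := by
      refine integral_eq_zero_of_ae ?_
      filter_upwards [Lp.coeFn_zero ℂ 2 (volume.restrict Ω)] with x hx
      rw [hx]
      simp
    have h2 : ∫ x in Ω, (φ x : ℂ) * (0 : L2Vec Ω) x i = 0 := by
      refine integral_eq_zero_of_ae ?_
      filter_upwards [Lp.coeFn_zero (EuclideanSpace ℂ (Fin d)) 2 (volume.restrict Ω)] with x hx
      rw [hx]
      simp
    change ∫ x in Ω, ((fderiv ℝ φ x (EuclideanSpace.single i 1) : ℝ) : ℂ) * (0 : L2 Ω) x
      = - ∫ x in Ω, (φ x : ℂ) * (0 : L2Vec Ω) x i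
    rw [h1, h2, neg_zero]
  add_mem' := by
    intro a b ha hb φ hφ hc hs i
    have iA := integrable_mul_of_test Ω (continuous_partial hφ (EuclideanSpace.single i 1))
      (hasCompactSupport_partial hc _) (Lp.memLp a.fst)
    have iB := integrable_mul_of_test Ω (continuous_partial hφ (EuclideanSpace.single i 1))
      (hasCompactSupport_partial hc _) (Lp.memLp b.fst)
    have jA := integrable_mul_of_test Ω hφ.continuous hc (memLp_coord a.snd i)
    have jB := integrable_mul_of_test Ω hφ.continuous hc (memLp_coord b.snd i)
    have h1 : ∫ x in Ω, ((fderiv ℝ φ x (EuclideanSpace.single i 1) : ℝ) : ℂ)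
          * (a.fst + b.fst : L2 Ω) x
        = ∫ x in Ω, (((fderiv ℝ φ x (EuclideanSpace.single i 1) : ℝ) : ℂ) * a.fst x
          + ((fderiv ℝ φ x (EuclideanSpace.single i 1) : ℝ) : ℂ) * b.fst x) := by
      refine integral_congr_ae ?_
      filter_upwards [Lp.coeFn_add a.fst b.fst] with x hx
      rw [hx]
      simp [mul_add]
    have h2 : ∫ x in Ω, (φ x : ℂ) * (a.snd + b.snd : L2Vec Ω) x i
        = ∫ x in Ω, ((φ x : ℂ) * a.snd x i + (φ x : ℂ) * b.snd x i) := by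
      refine integral_congr_ae ?_
      filter_upwards [Lp.coeFn_add a.snd b.snd] with x hx
      rw [hx]
      simp [mul_add]
    change ∫ x in Ω, ((fderiv ℝ φ x (EuclideanSpace.single i 1) : ℝ) : ℂ)
        * (a.fst + b.fst : L2 Ω) x = - ∫ x in Ω, (φ x : ℂ) * (a.snd + b.snd : L2Vec Ω) x i
    rw [h1, h2, integral_add iA iB, integral_add jA jB, ha φ hφ hc hs i, hb φ hφ hc hs i]
    ring
  smul_mem' := by
    intro c a ha φ hφ hc hs i
    have h1 : ∫ x in Ω, ((fderiv ℝ φ x (EuclideanSpace.single i 1) : ℝ) : ℂ)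
          * (c • a.fst : L2 Ω) x
        = ∫ x in Ω, (c : ℂ) * (((fderiv ℝ φ x (EuclideanSpace.single i 1) : ℝ) : ℂ)
          * a.fst x) := by
      refine integral_congr_ae ?_
      filter_upwards [Lp.coeFn_smul c a.fst] with x hx
      simp only [hx, Pi.smul_apply, Complex.real_smul]
      ring
    have h2 : ∫ x in Ω, (φ x : ℂ) * (c • a.snd : L2Vec Ω) x i
        = ∫ x in Ω, (c : ℂ) * ((φ x : ℂ) * a.snd x i) := by
      refine integral_congr_ae ?_
      filter_upwards [Lp.coeFn_smul c a.snd] with x hx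
      simp only [hx, Pi.smul_apply, PiLp.smul_apply, Complex.real_smul]
      ring
    change ∫ x in Ω, ((fderiv ℝ φ x (EuclideanSpace.single i 1) : ℝ) : ℂ)
        * (c • a.fst : L2 Ω) x = - ∫ x in Ω, (φ x : ℂ) * (c • a.snd : L2Vec Ω) x i
    rw [h1, h2, integral_const_mul, integral_const_mul, ha φ hφ hc hs i]
    ring

/-- The underlying `L²`-function of an element of `H¹(Ω)`. -/
def fn {d : ℕ} {Ω : Set (E d)} (v : H1 Ω) : L2 Ω := v.1.fst

/-- The weak gradient of an element of `H¹(Ω)`. -/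
def grad {d : ℕ} {Ω : Set (E d)} (v : H1 Ω) : L2Vec Ω := v.1.snd

/-- The weighted norm `‖v‖_{H¹_κ} = ‖v‖_{L²} + κ⁻¹ ‖∇v‖_{L²}`. -/
def h1kNorm {d : ℕ} {Ω : Set (E d)} (κ : ℝ) (v : H1 Ω) : ℝ :=
  ‖fn v‖ + κ⁻¹ * ‖grad v‖

/-- The norm `‖v‖_{L⁴(Ω)}`. -/
def l4Norm {d : ℕ} {Ω : Set (E d)} (v : H1 Ω) : ℝ≥0∞ :=
  eLpNorm (fn v) 4 (volume.restrict Ω)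

/-- The field `(i/κ) ∇v + A v`. -/
def covGrad {d : ℕ} {Ω : Set (E d)} (κ : ℝ) (A : E d → E d) (v : H1 Ω) (x : E d) :
    EuclideanSpace ℂ (Fin d) :=
  WithLp.toLp 2 fun j => Complex.I / (κ : ℂ) * grad v x j + (A x j : ℂ) * fn v x

/-- The Ginzburg--Landau energy. -/
def energy {d : ℕ} {Ω : Set (E d)} (κ : ℝ) (A : E d → E d) (v : H1 Ω) : ℝ :=
  1 / 2 * ∫ x in Ω, (‖covGrad κ A v x‖ ^ 2 + 1 / 2 * (‖fn v x‖ ^ 2 - 1) ^ 2)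

/-- `((i/κ) ∇v + A v, (i/κ) ∇w + A w)_{L²(Ω)}`. -/
def covForm {d : ℕ} {Ω : Set (E d)} (κ : ℝ) (A : E d → E d) (v w : H1 Ω) : ℝ :=
  (∫ x in Ω, ∑ j, covGrad κ A v x j * conj (covGrad κ A w x j)).re

/-- The first derivative `⟨E'(v), w⟩` of the energy. -/
def energyD1 {d : ℕ} {Ω : Set (E d)} (κ : ℝ) (A : E d → E d) (v w : H1 Ω) : ℝ :=
  covForm κ A v w
    + (∫ x in Ω, ((‖fn v x‖ ^ 2 - 1 : ℝ) : ℂ) * fn v x * conj (fn w x)).re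

/-- The second derivative `⟨E''(v) z, w⟩` of the energy. -/
def energyD2 {d : ℕ} {Ω : Set (E d)} (κ : ℝ) (A : E d → E d) (v z w : H1 Ω) : ℝ :=
  covForm κ A z w
    + (∫ x in Ω, (((2 * ‖fn v x‖ ^ 2 - 1 : ℝ) : ℂ) * fn z x + fn v x ^ 2 * conj (fn z x))
        * conj (fn w x)).re

/-- `(iu)^⊥ = {v ∈ H¹(Ω) | (iu, v)_{L²(Ω)} = 0}`. -/
def iuPerp {d : ℕ} {Ω : Set (E d)} (u : H1 Ω) : Set (H1 Ω) :=
  {v | l2Inner (Complex.I • fn u) (fn v) = 0}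

/-- `u` is a local minimizer of the energy satisfying the first order condition `E'(u) = 0` and
the sufficient second order condition. -/
structure IsNondegenerateLocalMin {d : ℕ} {Ω : Set (E d)} (κ : ℝ) (A : E d → E d) (u : H1 Ω) :
    Prop where
  isLocalMin : IsLocalMin (energy κ A) u
  first_order : ∀ v : H1 Ω, energyD1 κ A u v = 0
  second_order : ∀ v ∈ iuPerp u, v ≠ 0 → 0 < energyD2 κ A u v v

/-- `ρ(κ) = sup ‖v‖²_{H¹_κ} / ⟨E''(u)v, v⟩` over nonzero `v ∈ (iu)^⊥`. -/
def rho {d : ℕ} {Ω : Set (E d)} (κ : ℝ) (A : E d → E d) (u : H1 Ω) : ℝ≥0∞ :=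
  ⨆ v ∈ iuPerp u, ⨆ _ : v ≠ 0, ENNReal.ofReal (h1kNorm κ v ^ 2 / energyD2 κ A u v v)

/-- The closed reference simplex. -/
def refSimplex (d : ℕ) : Set (E d) := {x | (∀ j, 0 ≤ x j) ∧ ∑ j, x j ≤ 1}

/-- A finite partition of `Ω` into curved simplices, the images of the reference simplex under
bi-Lipschitz maps. -/
structure CurvedMesh {d : ℕ} (Ω : Set (E d)) where
  ι : Type
  finite_ι : Finite ι
  map : ι → E d → E d
  lipschitz : ∀ K, ∃ L : ℝ≥0, LipschitzOnWith L (map K) (refSimplex d)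
  antilipschitz : ∀ K, ∃ L : ℝ≥0, ∀ x ∈ refSimplex d, ∀ y ∈ refSimplex d,
    dist x y ≤ L * dist (map K x) (map K y)
  cover : ⋃ K, map K '' refSimplex d = closure Ω
  disjoint_interior : ∀ K K', K ≠ K' →
    Disjoint (interior (map K '' refSimplex d)) (interior (map K' '' refSimplex d))

/-- The Lagrange finite element space `V_h` of degree `p`: functions in `H¹(Ω)` that on each
element `K` agree a.e. with `P ∘ F_K⁻¹` for a complex polynomial `P` of total degree at most
`p`. -/
def feSpace {d : ℕ} {Ω : Set (E d)} (T : CurvedMesh Ω) (p : ℕ) : Submodule ℝ (H1 Ω) where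
  carrier := {v | ∀ K : T.ι, ∃ P : MvPolynomial (Fin d) ℂ, P.totalDegree ≤ p ∧
    ∀ᵐ y ∂(volume.restrict Ω), ∀ x ∈ refSimplex d, T.map K x = y →
      fn v y = MvPolynomial.eval (fun j => (x j : ℂ)) P}
  zero_mem' := by
    intro K
    refine ⟨0, by simp, ?_⟩
    filter_upwards [Lp.coeFn_zero ℂ 2 (volume.restrict Ω)] with y hy x _ _
    rw [map_zero]
    exact hy
  add_mem' := by
    intro a b ha hb K
    obtain ⟨P, hP, hPa⟩ := ha K
    obtain ⟨Q, hQ, hQb⟩ := hb K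
    refine ⟨P + Q, (MvPolynomial.totalDegree_add P Q).trans (max_le hP hQ), ?_⟩
    filter_upwards [hPa, hQb, Lp.coeFn_add (fn a) (fn b)] with y h1 h2 h3 x hx hxy
    rw [map_add, ← h1 x hx hxy, ← h2 x hx hxy]
    exact h3
  smul_mem' := by
    intro c a ha K
    obtain ⟨P, hP, hPa⟩ := ha K
    refine ⟨(c : ℂ) • P, (MvPolynomial.totalDegree_smul_le _ P).trans hP, ?_⟩
    filter_upwards [hPa, Lp.coeFn_smul c (fn a)] with y h1 h3 x hx hxy
    rw [MvPolynomial.smul_eval, ← h1 x hx hxy]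
    exact h3.trans (by simp)

/-- `z = E''(u)|_{(iu)^⊥}⁻¹ f`, i.e. `z ∈ (iu)^⊥` and `⟨E''(u) z, v⟩ = (f, v)_{L²}` for all
`v ∈ (iu)^⊥`. -/
def IsInverseImage {d : ℕ} {Ω : Set (E d)} (κ : ℝ) (A : E d → E d) (u : H1 Ω) (f : L2 Ω)
    (z : H1 Ω) : Prop :=
  z ∈ iuPerp u ∧ ∀ v ∈ iuPerp u, energyD2 κ A u z v = l2Inner f (fn v)

/-- The worst-case best-approximation error `η_h`. -/
def eta {d : ℕ} {Ω : Set (E d)} (κ : ℝ) (A : E d → E d) (u : H1 Ω) (V : Submodule ℝ (H1 Ω)) :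
    ℝ≥0∞ :=
  ⨆ (f : L2 Ω) (_ : ‖f‖ = 1) (z : H1 Ω) (_ : IsInverseImage κ A u f z),
    ⨅ v ∈ (V : Set (H1 Ω)) ∩ iuPerp u, ENNReal.ofReal (h1kNorm κ (z - v))

/-- `r = R_h(v)` is the Ritz projection of `v` onto `V_h ∩ (iu)^⊥` with respect to `E''(u)`. -/
def IsRitzProjection {d : ℕ} {Ω : Set (E d)} (κ : ℝ) (A : E d → E d) (u : H1 Ω)
    (V : Submodule ℝ (H1 Ω)) (v r : H1 Ω) : Prop :=
  r ∈ (V : Set (H1 Ω)) ∩ iuPerp u ∧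
    ∀ w ∈ (V : Set (H1 Ω)) ∩ iuPerp u, energyD2 κ A u r w = energyD2 κ A u v w

end GinzburgLandau

end

namespace GinzburgLandau

open Filter Topology ContinuousLinearMap
open scoped Convolution


/-! ### Approximation in `L¹` by mollification. -/

section Mollification

variable {V F : Type*} [NormedAddCommGroup V] [InnerProductSpace ℝ V] [FiniteDimensional ℝ V]
  [MeasurableSpace V] [BorelSpace V] [NormedAddCommGroup F]

/-! Put `e = u - uh` and `δ = r - uh`, where `r` is the Ritz projection of `u`. Since `δ` is an
admissible test function, Galerkin orthogonality gives `⟨E''(u)δ, δ⟩ = ⟨E''(u)e, δ⟩`. A Taylor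
expansion of the cubic term around `u` (`energyD2_sub_eq`) turns the right side into `⟨E'(u), δ⟩ -
⟨E'(uh), δ⟩` plus a remainder, and both first derivatives vanish on `δ`. What is left is an integral
of a remainder that is quadratic and cubic in `e`, tested with `δ`.

The remainder is at most `3|e|² + |e|³` because `|u| ≤ 1` almost everywhere. This maximum principle
(`norm_fn_le_one`) comes from testing `E'(u) = 0` with a smooth radial function of `u` that vanishes
where `|u| ≤ 1`. Hölder's inequality (`ofReal_remainder_le`) and the embedding `‖v‖_{L⁴} ≤ B κ^{d/4}
‖v‖_{H¹_κ}` (`exists_l4Norm_le`) bound the integral by a multiple of `‖δ‖_{H¹_κ}`. The definition of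
`ρ(κ)` bounds `‖δ‖²_{H¹_κ}` by `ρ(κ) ⟨E''(u)δ, δ⟩`, and one factor `‖δ‖_{H¹_κ}` cancels. Existence
and uniqueness of `r` follow from positive definiteness on the finite-dimensional space `V_h ∩
(iu)^⊥`.

Most of the work is the embedding, with a constant depending only on the domain. It is a
Gagliardo–Nirenberg inequality, obtained without an extension operator. Near each point of the
closure of a Lipschitz domain there is a basis of directions along which one cannot leave the
domain. Integrating the derivative of a cut-off function along these rays, and combining the
directions as in Gagliardo's proof, gives `W^{1,1} → L^{d/(d-1)}`. Applying this to smoothly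
truncated even powers of `|v|`, by the chain rule for weak gradients, gives the `L⁴` bound. -/

theorem tendsto_lintegral_translate_sub {g : V → F} (hg : Integrable g) :
    Tendsto (fun y : V => ∫⁻ x, ‖g (x - y) - g x‖ₑ) (𝓝 0) (𝓝 0) := by
  let G : Lp F 1 (volume : Measure V) := hg.toL1 g
  let τ : C(V, C(V, V)) := ContinuousMap.curry ⟨fun a : V × V => a.2 - a.1, by fun_prop⟩
  have hτ : ∀ y, MeasurePreserving (τ y) (volume : Measure V) volume := fun y =>
    measurePreserving_sub_right volume y
  have h1 : Tendsto (fun y => Lp.compMeasurePreserving (τ y) (hτ y) G) (𝓝 0)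
      (𝓝 (Lp.compMeasurePreserving (τ 0) (hτ 0) G)) :=
    tendsto_const_nhds.compMeasurePreservingLp (τ.continuous.tendsto 0) hτ (hτ 0) (by simp)
  have h2 := tendsto_iff_edist_tendsto_0.1 h1
  refine h2.congr fun y => ?_
  rw [Lp.edist_def, eLpNorm_one_eq_lintegral_enorm]
  refine lintegral_congr_ae ?_
  have hG : G =ᵐ[volume] g := hg.coeFn_toL1
  filter_upwards [Lp.coeFn_compMeasurePreserving G (hτ y),
    Lp.coeFn_compMeasurePreserving G (hτ 0), (hτ y).quasiMeasurePreserving.ae_eq_comp hG,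
    (hτ 0).quasiMeasurePreserving.ae_eq_comp hG] with x h3 h4 h5 h6
  rw [Pi.sub_apply, h3, h4, h5, h6]
  simp [τ]

/-- The kernel has mass one, so the error at `x` is an average of `g (x - y) - g x` over small `y`.
By Tonelli its `L¹` norm is at most an average of translation errors, and these are small by
continuity of translations in `L¹`. -/
theorem tendsto_lintegral_convolution_sub [NormedSpace ℝ F] [CompleteSpace F] {g : V → F} (hg : Integrable g)
    {φ : ℕ → ContDiffBump (0 : V)} (hφ : Tendsto (fun n => (φ n).rOut) atTop (𝓝 0)) :
    Tendsto (fun n => ∫⁻ x, ‖((φ n).normed volume ⋆[lsmul ℝ ℝ, volume] g) x - g x‖ₑ)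
      atTop (𝓝 0) := by
  rw [ENNReal.tendsto_nhds_zero]
  intro ε hε
  have h1 := (ENNReal.tendsto_nhds_zero.1 (tendsto_lintegral_translate_sub hg)) ε hε
  obtain ⟨δ, hδ, hball⟩ := Metric.eventually_nhds_iff_ball.1 h1
  filter_upwards [hφ.eventually (gt_mem_nhds hδ)] with n hn
  set ρ := (φ n).normed volume with hρ
  have hρ0 : ∀ y, 0 ≤ ρ y := fun y => (φ n).nonneg_normed y
  have hex : ∀ x, Integrable (fun y => ρ y • g (x - y)) := fun x =>
    ((φ n).hasCompactSupport_normed.convolutionExists_left (lsmul ℝ ℝ)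
      (φ n).continuous_normed hg.locallyIntegrable) x
  have hpt : ∀ x, ‖(ρ ⋆[lsmul ℝ ℝ, volume] g) x - g x‖ₑ
      ≤ ∫⁻ y, ENNReal.ofReal (ρ y) * ‖g (x - y) - g x‖ₑ := by
    intro x
    have h3 : (ρ ⋆[lsmul ℝ ℝ, volume] g) x - g x = ∫ y, ρ y • (g (x - y) - g x) := by
      rw [convolution_def]
      simp only [lsmul_apply, smul_sub]
      rw [integral_sub (hex x) ((φ n).integrable_normed.smul_const _),
        (φ n).integral_normed_smul]
    rw [h3]
    refine (enorm_integral_le_lintegral_enorm _).trans (le_of_eq ?_)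
    refine lintegral_congr fun y => ?_
    rw [enorm_smul, Real.enorm_of_nonneg (hρ0 y)]
  calc ∫⁻ x, ‖(ρ ⋆[lsmul ℝ ℝ, volume] g) x - g x‖ₑ
      ≤ ∫⁻ x, ∫⁻ y, ENNReal.ofReal (ρ y) * ‖g (x - y) - g x‖ₑ := lintegral_mono hpt
    _ = ∫⁻ y, ∫⁻ x, ENNReal.ofReal (ρ y) * ‖g (x - y) - g x‖ₑ := by
        refine lintegral_lintegral_swap ?_
        refine AEMeasurable.mul (f := fun p : V × V => ENNReal.ofReal (ρ p.2))
          (g := fun p : V × V => ‖g (p.1 - p.2) - g p.1‖ₑ) ?_ ?_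
        · exact ((φ n).continuous_normed.measurable.comp measurable_snd).ennreal_ofReal.aemeasurable
        · refine (AEStronglyMeasurable.sub ?_ ?_).enorm
          · exact hg.1.comp_quasiMeasurePreserving
              (quasiMeasurePreserving_sub_of_right_invariant volume volume)
          · exact hg.1.comp_quasiMeasurePreserving Measure.quasiMeasurePreserving_fst
    _ ≤ ∫⁻ y, ENNReal.ofReal (ρ y) * ε := by
        refine lintegral_mono fun y => ?_
        rw [lintegral_const_mul' _ _ ENNReal.ofReal_ne_top]
        by_cases hy : ρ y = 0
        · simp [hy]
        · have : y ∈ Function.support ρ := hy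
          rw [hρ, (φ n).support_normed_eq] at this
          exact mul_le_mul_right (hball y (Metric.ball_subset_ball hn.le this)) _
    _ = ε := by
        rw [lintegral_mul_const _ (φ n).continuous_normed.measurable.ennreal_ofReal,
          ← ofReal_integral_eq_lintegral_ofReal (φ n).integrable_normed
            (Eventually.of_forall hρ0), (φ n).integral_normed]
        simp

end Mollification


/-! ### The chain rule for weak gradients. -/

section ChainRule

variable {d : ℕ} {Ω : Set (E d)}

/-- The derivative falls on the kernel, and `y ↦ ρ (x - y)` is an admissible test function when the
ball around `x` lies inside `Ω`. The sign from differentiating in `y` instead of `x` cancels the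
sign in the definition of the weak gradient. -/
theorem fderiv_mollification_eq {v : E d → ℂ} {g : E d → EuclideanSpace ℂ (Fin d)}
    (hΩ : MeasurableSet Ω) (hv : IntegrableOn v Ω) (h : IsWeakGrad Ω v g) (i : Fin d)
    (ρ : ContDiffBump (0 : E d)) {x : E d} (hx : Metric.closedBall x ρ.rOut ⊆ Ω) :
    fderiv ℝ (ρ.normed volume ⋆[lsmul ℝ ℝ, volume] Ω.indicator v) x
        (EuclideanSpace.single i 1)
      = (ρ.normed volume ⋆[lsmul ℝ ℝ, volume] Ω.indicator fun y => g y i) x := by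
  set e : E d := EuclideanSpace.single i 1 with he
  have hvi : LocallyIntegrable (Ω.indicator v) :=
    ((integrable_indicator_iff hΩ).2 hv).locallyIntegrable
  have hρs : ContDiff ℝ ∞ (ρ.normed volume) := ρ.contDiff_normed
  have hcs := ρ.hasCompactSupport_normed (μ := volume)
  let L : ℝ →L[ℝ] ℂ →L[ℝ] ℂ := lsmul ℝ ℝ
  have h1 := hcs.hasFDerivAt_convolution_left L (hρs.of_le (by simp)) hvi x
  have hex : Integrable (fun t => (L.precompL (E d)) (fderiv ℝ (ρ.normed volume) t)
      (Ω.indicator v (x - t))) :=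
    HasCompactSupport.convolutionExists_left (μ := volume) (L.precompL (E d) :)
      (hcs.fderiv (𝕜 := ℝ)) (hρs.continuous_fderiv (by simp)) hvi x
  rw [h1.fderiv, convolution_def, ContinuousLinearMap.integral_apply hex, convolution_def,
    ← integral_sub_left_eq_self _ volume x]
  rw [← integral_sub_left_eq_self (fun t => (lsmul ℝ ℝ) (ρ.normed volume t) _) volume x]
  simp only [L, precompL_apply, lsmul_apply, sub_sub_cancel]
  let θ : E d → ℝ := fun y => ρ.normed volume (x - y)
  have hθs : ContDiff ℝ ∞ θ := hρs.comp (contDiff_const.sub contDiff_id)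
  have hθsupp : Function.support θ ⊆ Metric.closedBall x ρ.rOut := by
    intro y hy
    have : x - y ∈ Function.support (ρ.normed volume) := hy
    rw [ρ.support_normed_eq, mem_ball_zero_iff] at this
    rw [Metric.mem_closedBall, dist_comm, dist_eq_norm]
    exact this.le
  have hθt : tsupport θ ⊆ Metric.closedBall x ρ.rOut :=
    closure_minimal hθsupp Metric.isClosed_closedBall
  have hθc : HasCompactSupport θ :=
    HasCompactSupport.intro (isCompact_closedBall x ρ.rOut) fun y hy => by
      by_contra hne
      exact hy (hθsupp hne)
  have hθd : ∀ y, fderiv ℝ θ y e = - fderiv ℝ (ρ.normed volume) (x - y) e := by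
    intro y
    have h2 : HasFDerivAt θ ((fderiv ℝ (ρ.normed volume) (x - y)).comp
        (0 - ContinuousLinearMap.id ℝ (E d))) y :=
      ((hρs.differentiable (by simp)) (x - y)).hasFDerivAt.comp y
        ((hasFDerivAt_const x y).sub (hasFDerivAt_id y))
    rw [h2.fderiv]
    simp
  have key := h θ hθs hθc (hθt.trans hx) i
  simp only [← he, hθd] at key
  have e1 : ∫ y, fderiv ℝ (ρ.normed volume) (x - y) e • Ω.indicator v y
      = ∫ y in Ω, ((fderiv ℝ (ρ.normed volume) (x - y) e : ℝ) : ℂ) * v y := by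
    rw [← integral_indicator hΩ]
    congr 1
    ext y
    by_cases hy : y ∈ Ω <;> simp [hy]
  have e2 : ∫ y, ρ.normed volume (x - y) • Ω.indicator (fun y => g y i) y
      = ∫ y in Ω, (θ y : ℂ) * g y i := by
    rw [← integral_indicator hΩ]
    congr 1
    ext y
    by_cases hy : y ∈ Ω <;> simp [hy, θ]
  rw [e1, e2]
  have e3 : ∫ y in Ω, ((-fderiv ℝ (ρ.normed volume) (x - y) e : ℝ) : ℂ) * v y
      = - ∫ y in Ω, ((fderiv ℝ (ρ.normed volume) (x - y) e : ℝ) : ℂ) * v y := by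
    rw [← integral_neg]
    simp
  rw [e3] at key
  exact neg_injective key

/-- A sequence of bump functions around the origin whose supports shrink to the origin. -/
noncomputable def shrinkingBump (d : ℕ) (n : ℕ) : ContDiffBump (0 : E d) where
  rIn := 1 / (n + 1) / 2
  rOut := 1 / (n + 1)
  rIn_pos := by positivity
  rIn_lt_rOut := half_lt_self (by positivity)

theorem tendsto_shrinkingBump : Tendsto (fun n => (shrinkingBump d n).rOut) atTop (𝓝 0) :=
  tendsto_one_div_add_atTop_nhds_zero_nat

/-- The chain rule for weak gradients. -/
theorem IsWeakGrad.comp (hΩ : IsOpen Ω) {v : E d → ℂ} {g : E d → EuclideanSpace ℂ (Fin d)}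
    (hv : IntegrableOn v Ω) (hg : IntegrableOn g Ω) (h : IsWeakGrad Ω v g) {G : ℂ → ℂ}
    (hG : ContDiff ℝ 1 G) {M : ℝ} (hM : ∀ z, ‖fderiv ℝ G z‖ ≤ M) :
    IsWeakGrad Ω (fun x => G (v x))
      (fun x => WithLp.toLp 2 fun i => fderiv ℝ G (v x) (g x i)) := by
  intro φ hφ hφc hφs i
  set e : E d := EuclideanSpace.single i 1 with he
  have hGl : ∀ z w, ‖G z - G w‖ ≤ M * ‖z - w‖ := fun z w =>
    convex_univ.norm_image_sub_le_of_norm_fderiv_le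
      (fun x _ => (hG.differentiable one_ne_zero) x) (fun x _ => hM x) (mem_univ w) (mem_univ z)
  have hGc := hG.continuous
  have hDGc := hG.continuous_fderiv one_ne_zero
  obtain ⟨δ, hδ, hδs⟩ := IsCompact.exists_cthickening_subset_open hφc hΩ hφs
  set v₀ := Ω.indicator v with hv₀
  set g₀ := Ω.indicator (fun y => g y i) with hg₀
  have hgi : IntegrableOn (fun y => g y i) Ω :=
    (EuclideanSpace.proj (𝕜 := ℂ) i).integrable_comp hg
  have hv₀i : Integrable v₀ := (integrable_indicator_iff hΩ.measurableSet).2 hv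
  have hg₀i : Integrable g₀ := (integrable_indicator_iff hΩ.measurableSet).2 hgi
  let ρ : ℕ → ContDiffBump (0 : E d) := shrinkingBump d
  have hρ : Tendsto (fun n => (ρ n).rOut) atTop (𝓝 0) := tendsto_shrinkingBump
  -- Bounded eccentricity of the bumps is what the Lebesgue differentiation theorem needs to give
  -- almost everywhere convergence of the mollifications.
  have hρK : ∀ᶠ n in atTop, (ρ n).rOut ≤ 2 * (ρ n).rIn := Eventually.of_forall fun n => by
    simp only [ρ, shrinkingBump]
    linarith
  let k : ℕ → E d → ℂ := fun n => (ρ n).normed volume ⋆[lsmul ℝ ℝ, volume] v₀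
  let m : ℕ → E d → ℂ := fun n => (ρ n).normed volume ⋆[lsmul ℝ ℝ, volume] g₀
  have hkC : ∀ n, ContDiff ℝ 1 (k n) := fun n => by
    have h0 : ContDiff ℝ ((1 : ℕ∞) : WithTop ℕ∞) ((ρ n).normed (volume : Measure (E d))) :=
      (ρ n).contDiff_normed
    exact (ρ n).hasCompactSupport_normed.contDiff_convolution_left (lsmul ℝ ℝ)
      h0 hv₀i.locallyIntegrable
  have hmC : ∀ n, Continuous (m n) := fun n =>
    (ρ n).hasCompactSupport_normed.continuous_convolution_left (lsmul ℝ ℝ)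
      (ρ n).continuous_normed hg₀i.locallyIntegrable
  have hkd : ∀ᶠ n in atTop, ∀ x ∈ tsupport φ, fderiv ℝ (k n) x e = m n x := by
    filter_upwards [hρ.eventually (gt_mem_nhds hδ)] with n hn x hx
    refine fderiv_mollification_eq hΩ.measurableSet hv h i (ρ n) (Subset.trans ?_ hδs)
    exact (Metric.closedBall_subset_closedBall hn.le).trans
      (Metric.closedBall_subset_cthickening hx δ)
  have hφ0 : Continuous φ := hφ.continuous
  have hdφ0 := continuous_partial hφ e
  have hdφc := hasCompactSupport_partial hφc e
  obtain ⟨Cφ, hCφ⟩ := hφ0.bounded_above_of_compact_support hφc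
  obtain ⟨Cd, hCd⟩ := hdφ0.bounded_above_of_compact_support hdφc
  -- the chain rule for mollifications
  have hchain : ∀ n x, fderiv ℝ (fun y => G (k n y)) x e
      = fderiv ℝ G (k n x) (fderiv ℝ (k n) x e) := fun n x => by
    have := ((hG.differentiable one_ne_zero) (k n x)).hasFDerivAt.comp x
      ((hkC n).differentiable one_ne_zero x).hasFDerivAt
    have h2 := this.fderiv
    simp only [Function.comp_def] at h2
    rw [h2]
    rfl
  have hparts : ∀ᶠ n in atTop, ∫ x, fderiv ℝ φ x e • G (k n x)
      = - ∫ x, φ x • fderiv ℝ G (k n x) (m n x) := by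
    filter_upwards [hkd] with n hn
    have hGk : ContDiff ℝ 1 (fun y => G (k n y)) := hG.comp (hkC n)
    have := integral_smul_fderiv_eq_neg_fderiv_smul_of_integrable (μ := (volume : Measure (E d)))
      (f := φ) (g := fun y => G (k n y)) (v := e)
      ((hdφ0.smul hGk.continuous).integrable_of_hasCompactSupport hdφc.smul_right)
      ((hφ0.smul ((hGk.continuous_fderiv one_ne_zero).clm_apply
        continuous_const)).integrable_of_hasCompactSupport hφc.smul_right)
      ((hφ0.smul hGk.continuous).integrable_of_hasCompactSupport hφc.smul_right)
      (fun x _ => hφ.differentiable (by simp) x)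
      (fun x _ => hGk.differentiable one_ne_zero x)
    rw [← neg_eq_iff_eq_neg.2 this]
    congr 2
    ext x
    by_cases hx : x ∈ tsupport φ
    · rw [hchain, hn x hx]
    · simp [image_eq_zero_of_notMem_tsupport hx]
  -- passage to the limit
  have hlim1 : Tendsto (fun n => ∫ x, fderiv ℝ φ x e • G (k n x)) atTop
      (𝓝 (∫ x, fderiv ℝ φ x e • G (v₀ x))) := by
    refine tendsto_integral_of_L1 _ ?_ (Eventually.of_forall fun n => ?_) ?_
    · exact hdφ0.aestronglyMeasurable.smul (hGc.comp_aestronglyMeasurable hv₀i.1)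
    · exact (hdφ0.smul (hGc.comp (hkC n).continuous)).integrable_of_hasCompactSupport
        hdφc.smul_right
    · have h0 := ENNReal.Tendsto.const_mul (a := ENNReal.ofReal (Cd * M))
        (tendsto_lintegral_convolution_sub hv₀i hρ) (Or.inr ENNReal.ofReal_ne_top)
      rw [mul_zero] at h0
      refine tendsto_of_tendsto_of_tendsto_of_le_of_le tendsto_const_nhds h0
        (fun _ => zero_le) fun n => ?_
      dsimp only
      rw [← lintegral_const_mul' _ _ ENNReal.ofReal_ne_top]
      refine lintegral_mono fun x => ?_
      rw [← smul_sub, ← ofReal_norm, ← ofReal_norm,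
        ← ENNReal.ofReal_mul' (norm_nonneg _), norm_smul]
      refine ENNReal.ofReal_le_ofReal ?_
      rw [mul_assoc]
      exact mul_le_mul (hCd x) (hGl _ _) (norm_nonneg _) ((norm_nonneg _).trans (hCd x))
  have hlim2 : Tendsto (fun n => ∫ x, φ x • fderiv ℝ G (k n x) (m n x)) atTop
      (𝓝 (∫ x, φ x • fderiv ℝ G (v₀ x) (g₀ x))) := by
    have hmeas : ∀ f : E d → ℂ, AEStronglyMeasurable f volume →
        ∀ g : E d → ℂ, AEStronglyMeasurable g volume →
        AEStronglyMeasurable (fun x => fderiv ℝ G (f x) (g x)) volume := fun f hf g hg =>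
      isBoundedBilinearMap_apply.continuous.comp_aestronglyMeasurable
        ((hDGc.comp_aestronglyMeasurable hf).prodMk hg)
    refine tendsto_integral_of_L1 _ ?_ (Eventually.of_forall fun n => ?_) ?_
    · exact hφ0.aestronglyMeasurable.smul (hmeas _ hv₀i.1 _ hg₀i.1)
    · exact (hφ0.smul ((hDGc.comp (hkC n).continuous).clm_apply
        (hmC n))).integrable_of_hasCompactSupport hφc.smul_right
    · have h0 := ENNReal.Tendsto.const_mul (a := ENNReal.ofReal (Cφ * M))
        (tendsto_lintegral_convolution_sub hg₀i hρ) (Or.inr ENNReal.ofReal_ne_top)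
      -- Only `m n → g₀` is controlled in norm. The change of the coefficient `fderiv ℝ G (k n x)`
      -- is handled by dominated convergence, using continuity of the derivative and the pointwise
      -- limit `k n → v₀`.
      have h1 : Tendsto (fun n => ∫⁻ x,
          ‖φ x • (fderiv ℝ G (k n x) (g₀ x) - fderiv ℝ G (v₀ x) (g₀ x))‖ₑ) atTop
          (𝓝 (∫⁻ _ : E d, 0)) := by
        refine tendsto_lintegral_of_dominated_convergence'
          (fun x => ENNReal.ofReal (Cφ * (2 * M)) * ‖g₀ x‖ₑ) (fun n => ?_)
          (fun n => Eventually.of_forall fun x => ?_) ?_ ?_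
        · exact (hφ0.aestronglyMeasurable.smul ((hmeas _ (hkC n).continuous.aestronglyMeasurable
            _ hg₀i.1).sub (hmeas _ hv₀i.1 _ hg₀i.1))).enorm
        · dsimp only
          rw [← ofReal_norm, ← ofReal_norm,
            ← ENNReal.ofReal_mul' (norm_nonneg _), norm_smul, mul_assoc]
          refine ENNReal.ofReal_le_ofReal ?_
          refine mul_le_mul (hCφ x) ?_ (norm_nonneg _) ((norm_nonneg _).trans (hCφ x))
          refine (norm_sub_le _ _).trans ?_
          rw [two_mul, add_mul]
          exact add_le_add (le_of_opNorm_le _ (hM _) _) (le_of_opNorm_le _ (hM _) _)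
        · rw [lintegral_const_mul' _ _ ENNReal.ofReal_ne_top]
          exact ENNReal.mul_ne_top ENNReal.ofReal_ne_top hg₀i.2.ne
        · filter_upwards [ContDiffBump.ae_convolution_tendsto_right_of_locallyIntegrable
            (μ := volume) hρ hρK hv₀i.locallyIntegrable] with x hx
          have h3 : Tendsto (fun n => fderiv ℝ G (k n x) (g₀ x)) atTop
              (𝓝 (fderiv ℝ G (v₀ x) (g₀ x))) :=
            (((hDGc.clm_apply continuous_const).tendsto (v₀ x)).comp hx)
          have h4 := ((h3.sub_const (fderiv ℝ G (v₀ x) (g₀ x))).const_smul (φ x)).enorm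
          simpa using h4
      rw [lintegral_zero] at h1
      have h2 := h0.add h1
      rw [mul_zero, add_zero] at h2
      refine tendsto_of_tendsto_of_tendsto_of_le_of_le tendsto_const_nhds h2
        (fun _ => zero_le) fun n => ?_
      dsimp only
      rw [← lintegral_const_mul' _ _ ENNReal.ofReal_ne_top, ← lintegral_add_right' _ (by
        exact (hφ0.aestronglyMeasurable.smul ((hmeas _ (hkC n).continuous.aestronglyMeasurable
            _ hg₀i.1).sub (hmeas _ hv₀i.1 _ hg₀i.1))).enorm)]
      refine lintegral_mono fun x => ?_
      have e1 : φ x • fderiv ℝ G (k n x) (m n x) - φ x • fderiv ℝ G (v₀ x) (g₀ x)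
          = φ x • fderiv ℝ G (k n x) (m n x - g₀ x)
            + φ x • (fderiv ℝ G (k n x) (g₀ x) - fderiv ℝ G (v₀ x) (g₀ x)) := by
        rw [map_sub, ← smul_add, ← smul_sub]
        congr 1
        abel
      rw [e1]
      refine (enorm_add_le _ _).trans (add_le_add ?_ le_rfl)
      rw [← ofReal_norm, ← ofReal_norm,
        ← ENNReal.ofReal_mul' (norm_nonneg _), norm_smul, mul_assoc]
      refine ENNReal.ofReal_le_ofReal ?_
      exact mul_le_mul (hCφ x) (le_of_opNorm_le _ (hM _) _) (norm_nonneg _)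
        ((norm_nonneg _).trans (hCφ x))
  have hfin := tendsto_nhds_unique hlim1 (hlim2.neg.congr' (hparts.mono fun n hn => hn.symm))
  have hout : ∀ x, x ∉ Ω → φ x = 0 := fun x hx =>
    image_eq_zero_of_notMem_tsupport fun h => hx (hφs h)
  have hout' : ∀ x, x ∉ Ω → fderiv ℝ φ x e = 0 := fun x hx => by
    have : x ∉ tsupport (fderiv ℝ φ) := fun h => hx (hφs (tsupport_fderiv_subset ℝ h))
    rw [image_eq_zero_of_notMem_tsupport this]
    rfl
  have hl : ∫ x in Ω, fderiv ℝ φ x e • G (v₀ x) = ∫ x, fderiv ℝ φ x e • G (v₀ x) :=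
    setIntegral_eq_integral_of_forall_compl_eq_zero fun x hx => by rw [hout' x hx, zero_smul]
  have hr : ∫ x in Ω, φ x • fderiv ℝ G (v₀ x) (g₀ x) = ∫ x, φ x • fderiv ℝ G (v₀ x) (g₀ x) :=
    setIntegral_eq_integral_of_forall_compl_eq_zero fun x hx => by rw [hout x hx, zero_smul]
  rw [← hl, ← hr] at hfin
  have hl' : ∫ x in Ω, ((fderiv ℝ φ x e : ℝ) : ℂ) * G (v x)
      = ∫ x in Ω, fderiv ℝ φ x e • G (v₀ x) :=
    setIntegral_congr_fun hΩ.measurableSet fun x hx => by simp [hv₀, hx]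
  have hr' : ∫ x in Ω, (φ x : ℂ) * fderiv ℝ G (v x) (g x i)
      = ∫ x in Ω, φ x • fderiv ℝ G (v₀ x) (g₀ x) :=
    setIntegral_congr_fun hΩ.measurableSet fun x hx => by simp [hv₀, hg₀, hx]
  exact hl'.trans (hfin.trans (congrArg _ hr'.symm))

end ChainRule


/-! ### Bounding a cut-off function by integrals along rays that stay in the domain. -/

section Rays

variable {d : ℕ} {Ω : Set (E d)}

/-- The average of a function over a segment in direction `-e`, as a function of the endpoint. -/
noncomputable def segmentIntegral (φ : E d → ℝ) (e : E d) (T : ℝ) (x : E d) : ℝ :=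
  ∫ t in (0 : ℝ)..T, φ (x - t • e)

/-- The segment integral is a convolution of `φ` with the image of Lebesgue measure on `(0, T]`
under `t ↦ t • e`, so it inherits the smoothness of `φ`. -/
theorem contDiff_segmentIntegral {φ : E d → ℝ} (hφ : ContDiff ℝ ∞ φ) (hc : HasCompactSupport φ)
    (e : E d) {T : ℝ} (hT : 0 ≤ T) : ContDiff ℝ ∞ (segmentIntegral φ e T) := by
  have hm : Measurable fun t : ℝ => t • e := by fun_prop
  let μ : Measure (E d) := (volume.restrict (Ioc 0 T)).map fun t : ℝ => t • e
  have : IsFiniteMeasure μ := Measure.isFiniteMeasure_map _ _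
  have h1 : ContDiff ℝ ∞ ((fun _ => (1 : ℝ)) ⋆[lsmul ℝ ℝ, μ] φ) :=
    hc.contDiff_convolution_right (lsmul ℝ ℝ) (integrable_const _).locallyIntegrable hφ
  convert h1 using 1
  ext x
  rw [convolution_def, integral_map hm.aemeasurable]
  · simp [segmentIntegral, intervalIntegral.integral_of_le hT]
  · exact (Continuous.aestronglyMeasurable (by
      have := hφ.continuous
      simp only [lsmul_apply, smul_eq_mul, one_mul]
      fun_prop))

theorem fderiv_segmentIntegral {φ : E d → ℝ} (hφ : ContDiff ℝ ∞ φ) (hc : HasCompactSupport φ)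
    (e : E d) {T : ℝ} (hT : 0 ≤ T) (x : E d) :
    fderiv ℝ (segmentIntegral φ e T) x e = φ x - φ (x - T • e) := by
  have hφ0 := hφ.continuous
  have h1 : HasDerivAt (fun s : ℝ => segmentIntegral φ e T (x + s • e))
      (fderiv ℝ (segmentIntegral φ e T) x e) 0 := by
    have hd := ((contDiff_segmentIntegral hφ hc e hT).differentiable (by simp) x).hasFDerivAt
    have hl : HasDerivAt (fun s : ℝ => x + s • e) e 0 := by
      simpa using ((hasDerivAt_id (0 : ℝ)).smul_const e).const_add x
    exact HasFDerivAt.comp_hasDerivAt (0 : ℝ) (by simpa using hd) hl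
  have hc' : Continuous fun t : ℝ => φ (x + t • e) := by fun_prop
  have h2 : HasDerivAt (fun s : ℝ => segmentIntegral φ e T (x + s • e))
      (φ x - φ (x - T • e)) 0 := by
    have e1 : (fun s : ℝ => segmentIntegral φ e T (x + s • e))
        = fun s : ℝ => (∫ t in (0 : ℝ)..s, φ (x + t • e))
          - ∫ t in (0 : ℝ)..(s - T), φ (x + t • e) := by
      ext s
      rw [intervalIntegral.integral_interval_sub_left (hc'.intervalIntegrable _ _)
        (hc'.intervalIntegrable _ _)]
      have := intervalIntegral.integral_comp_sub_left (a := 0) (b := T)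
        (fun t : ℝ => φ (x + t • e)) s
      rw [sub_zero] at this
      rw [← this]
      refine intervalIntegral.integral_congr fun t _ => ?_
      simp only [sub_smul]
      congr 1
      abel
    rw [e1]
    have a1 := (hc'.integral_hasStrictDerivAt 0 0).hasDerivAt
    have a2 : HasDerivAt (fun s : ℝ => ∫ t in (0 : ℝ)..(s - T), φ (x + t • e))
        (φ (x + (0 - T) • e)) 0 :=
      HasDerivAt.comp_sub_const (0 : ℝ) T (hc'.integral_hasStrictDerivAt 0 (0 - T)).hasDerivAt
    have e2 : φ x - φ (x - T • e) = φ (x + (0 : ℝ) • e) - φ (x + (0 - T) • e) := by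
      simp [sub_eq_add_neg]
    rw [e2]
    exact a1.sub a2
  exact h1.unique h2

/-- The support only spreads in the direction `+e`. This one-sidedness lets the segment integral of
a test function, once cut off, remain a test function in `Ω`. -/
theorem segmentIntegral_support {φ : E d → ℝ} (hc : HasCompactSupport φ)
    (e : E d) {T : ℝ} (hT : 0 ≤ T) {x : E d} (hx : x ∈ tsupport (segmentIntegral φ e T)) :
    ∃ y ∈ tsupport φ, ∃ t : ℝ, 0 ≤ t ∧ x = y + t • e := by
  let S : Set (E d) := (fun p : E d × ℝ => p.1 + p.2 • e) '' (tsupport φ ×ˢ Icc 0 T)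
  have hS : IsCompact S :=
    (IsCompact.prod hc isCompact_Icc).image (by fun_prop)
  have hsub : tsupport (segmentIntegral φ e T) ⊆ S := by
    refine closure_minimal (fun z hz => ?_) hS.isClosed
    by_contra hne
    refine hz ?_
    rw [segmentIntegral, intervalIntegral.integral_of_le hT]
    refine setIntegral_eq_zero_of_forall_eq_zero fun t ht => ?_
    by_contra h0
    exact hne ⟨(z - t • e, t), ⟨subset_tsupport _ h0, ht.1.le, ht.2⟩, by simp⟩
  obtain ⟨⟨y, t⟩, ⟨hy, ht⟩, rfl⟩ := hsub hx
  exact ⟨y, hy, t, ht.1, rfl⟩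

/-- The component of a vector field in a fixed direction. -/
noncomputable def dirComp (e : E d) (z : EuclideanSpace ℂ (Fin d)) : ℂ := ∑ i, (e i : ℂ) * z i

theorem norm_dirComp_le (e : E d) (z : EuclideanSpace ℂ (Fin d)) :
    ‖dirComp e z‖ ≤ (∑ i, ‖e i‖) * ‖z‖ := by
  rw [dirComp, Finset.sum_mul]
  refine (norm_sum_le _ _).trans (Finset.sum_le_sum fun i _ => ?_)
  rw [norm_mul, Complex.norm_real]
  gcongr
  exact PiLp.norm_apply_le z i

theorem integrableOn_dirComp {g : E d → EuclideanSpace ℂ (Fin d)} (hg : IntegrableOn g Ω)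
    (e : E d) : IntegrableOn (fun x => dirComp e (g x)) Ω := by
  refine integrable_finsetSum _ fun i _ => Integrable.const_mul ?_ _
  exact (EuclideanSpace.proj (𝕜 := ℂ) i).integrable_comp hg

theorem integrable_bounded_mul {μ : Measure (E d)} {f : E d → ℝ} (hf : Continuous f)
    (hc : HasCompactSupport f) {v : E d → ℂ} (hv : Integrable v μ) :
    Integrable (fun x => (f x : ℂ) * v x) μ := by
  obtain ⟨C, hC⟩ := hf.bounded_above_of_compact_support hc
  exact hv.bdd_mul (Complex.continuous_ofReal.comp hf).aestronglyMeasurable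
    (Eventually.of_forall fun x => by simpa using hC x)

theorem IsWeakGrad.directional {v : E d → ℂ} {g : E d → EuclideanSpace ℂ (Fin d)}
    (hv : IntegrableOn v Ω) (hg : IntegrableOn g Ω) (h : IsWeakGrad Ω v g) (e : E d)
    {φ : E d → ℝ} (hφ : ContDiff ℝ ∞ φ) (hc : HasCompactSupport φ) (hs : tsupport φ ⊆ Ω) :
    ∫ x in Ω, ((fderiv ℝ φ x e : ℝ) : ℂ) * v x
      = - ∫ x in Ω, (φ x : ℂ) * dirComp e (g x) := by
  have he : e = ∑ i, e i • (EuclideanSpace.single i (1 : ℝ) : E d) := by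
    ext j
    simp [Finset.sum_apply, Pi.single_apply]
  have e1 : ∀ x, ((fderiv ℝ φ x e : ℝ) : ℂ) * v x
      = ∑ i, (e i : ℂ) * (((fderiv ℝ φ x (EuclideanSpace.single i 1) : ℝ) : ℂ) * v x) := by
    intro x
    conv_lhs => rw [he]
    rw [map_sum, Complex.ofReal_sum, Finset.sum_mul]
    refine Finset.sum_congr rfl fun i _ => ?_
    rw [map_smul, smul_eq_mul, Complex.ofReal_mul]
    ring
  have e2 : ∀ x, (φ x : ℂ) * dirComp e (g x) = ∑ i, (e i : ℂ) * ((φ x : ℂ) * g x i) := by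
    intro x
    rw [dirComp, Finset.mul_sum]
    exact Finset.sum_congr rfl fun i _ => by ring
  simp only [e1, e2]
  rw [integral_finsetSum, integral_finsetSum, ← Finset.sum_neg_distrib]
  · refine Finset.sum_congr rfl fun i _ => ?_
    rw [integral_const_mul, integral_const_mul, h φ hφ hc hs i, mul_neg]
  · exact fun i _ => (integrable_bounded_mul hφ.continuous hc
      ((EuclideanSpace.proj (𝕜 := ℂ) i).integrable_comp hg)).const_mul _
  · exact fun i _ => (integrable_bounded_mul (continuous_partial hφ _)
      (hasCompactSupport_partial hc _) hv).const_mul _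

/-- The derivative in direction `e` of the product of a cutoff function and a weakly
differentiable function. -/
noncomputable def cutoffDeriv (χ : E d → ℝ) (v : E d → ℂ) (g : E d → EuclideanSpace ℂ (Fin d))
    (e : E d) (x : E d) : ℂ :=
  ((fderiv ℝ χ x e : ℝ) : ℂ) * v x + (χ x : ℂ) * dirComp e (g x)

theorem integrable_shear {h : E d → ℂ} (hh : Integrable h) (e : E d) (T : ℝ) :
    Integrable (fun p : ℝ × E d => h (p.2 + p.1 • e))
      ((volume.restrict (Ioc 0 T)).prod volume) := by
  have hmp : MeasurePreserving (fun p : ℝ × E d => (p.1, p.2 + p.1 • e))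
      ((volume.restrict (Ioc 0 T)).prod volume) ((volume.restrict (Ioc 0 T)).prod volume) :=
    (MeasurePreserving.id _).skew_product (g := fun t x => x + t • e)
      (by fun_prop) (Eventually.of_forall fun t => map_add_right_eq_self volume (t • e))
  exact hmp.integrable_comp_of_integrable (hh.comp_snd _)

/-- This is the fundamental theorem of calculus along rays, proved by duality so that no
representative of `v` has to be differentiated on lines. For a test function `φ`, the primitive `ψ =
segmentIntegral φ e T` has `∂ₑψ = φ` on the support of `χ`. Using `χ ψ` as test function in the weak
derivative and applying Fubini shows that `χ v` equals minus the integral of its derivative along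
the forward ray. -/
theorem IsWeakGrad.enorm_cutoff_le_lintegral_ray (hΩ : IsOpen Ω) {v : E d → ℂ}
    {g : E d → EuclideanSpace ℂ (Fin d)}
    (hv : IntegrableOn v Ω) (hg : IntegrableOn g Ω) (h : IsWeakGrad Ω v g)
    {x₀ e : E d} {r : ℝ} (he : e ≠ 0)
    (hray : ∀ y ∈ Ω ∩ Metric.ball x₀ r, ∀ t : ℝ, 0 ≤ t → y + t • e ∈ Metric.ball x₀ r →
      y + t • e ∈ Ω)
    {χ : E d → ℝ} (hχ : ContDiff ℝ ∞ χ) (hχc : HasCompactSupport χ)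
    (hχs : tsupport χ ⊆ Metric.ball x₀ r) :
    ∀ᵐ y, y ∈ Ω → ‖(χ y : ℂ) * v y‖ₑ
      ≤ ∫⁻ t : ℝ, ‖Ω.indicator (cutoffDeriv χ v g e) (y + t • e)‖ₑ := by
  by_cases hr : r ≤ 0
  · refine Eventually.of_forall fun y _ => ?_
    have : y ∉ tsupport χ := fun hy => by
      have := hχs hy
      rw [Metric.ball_eq_empty.2 hr] at this
      exact this
    simp [image_eq_zero_of_notMem_tsupport this]
  push Not at hr
  have hen : 0 < ‖e‖ := norm_pos_iff.2 he
  -- A step of length `2r` leads from any point of the ball to a point outside, so the far endpoint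
  -- term of `∂ₑψ` vanishes wherever `χ` does not.
  set T : ℝ := 2 * r / ‖e‖ with hT
  have hT0 : 0 ≤ T := by positivity
  set H := Ω.indicator (cutoffDeriv χ v g e) with hH
  have hHi : Integrable H := by
    refine (integrable_indicator_iff hΩ.measurableSet).2 (Integrable.add ?_ ?_)
    · exact integrable_bounded_mul (continuous_partial hχ e) (hasCompactSupport_partial hχc e) hv
    · exact integrable_bounded_mul hχ.continuous hχc (integrableOn_dirComp hg e)
  let J : E d → ℂ := fun y => ∫ t in Ioc 0 T, H (y + t • e)
  have hsh := integrable_shear hHi e T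
  have hJi : Integrable J := hsh.integral_prod_right
  have hχv : Integrable (Ω.indicator fun y => (χ y : ℂ) * v y) :=
    (integrable_indicator_iff hΩ.measurableSet).2
      (integrable_bounded_mul hχ.continuous hχc hv)
  have hU : IsOpen (Ω ∩ Metric.ball x₀ r) := hΩ.inter Metric.isOpen_ball
  have key := hU.ae_eq_zero_of_integral_contDiff_smul_eq_zero (μ := volume)
    (f := fun y => Ω.indicator (fun y => (χ y : ℂ) * v y) y + J y)
    ((hχv.add hJi).locallyIntegrable.locallyIntegrableOn _) (fun φ hφ hφc hφs => ?_)
  · filter_upwards [key] with y hy hyΩ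
    by_cases hyb : y ∈ Metric.ball x₀ r
    · have h1 := hy ⟨hyΩ, hyb⟩
      rw [indicator_of_mem hyΩ, add_eq_zero_iff_eq_neg] at h1
      rw [h1, enorm_neg]
      exact (enorm_integral_le_lintegral_enorm _).trans (setLIntegral_le_lintegral _ _)
    · simp [image_eq_zero_of_notMem_tsupport fun h => hyb (hχs h)]
  · set ψ := segmentIntegral φ e T with hψ
    have hψC := contDiff_segmentIntegral hφ hφc e hT0
    have hθC : ContDiff ℝ ∞ fun x => χ x * ψ x := hχ.mul hψC
    have hθc : HasCompactSupport fun x => χ x * ψ x := hχc.mul_right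
    -- A point of the support of `χ ψ` lies in the ball and is reached from a point of `Ω` by moving
    -- forward along `e`, so `hray` puts it in `Ω`.
    have hθs : tsupport (fun x => χ x * ψ x) ⊆ Ω := by
      intro x hx
      obtain ⟨y, hy, t, ht, rfl⟩ :=
        segmentIntegral_support hφc e hT0 (tsupport_mul_subset_right hx)
      exact hray y (hφs hy) t ht (hχs (tsupport_mul_subset_left hx))
    have hD : ∀ x, fderiv ℝ (fun x => χ x * ψ x) x e
        = χ x * φ x + ψ x * fderiv ℝ χ x e := by
      intro x
      rw [fderiv_fun_mul (hχ.differentiable (by simp) x) (hψC.differentiable (by simp) x)]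
      simp only [add_apply, smul_apply, smul_eq_mul]
      rw [hψ, fderiv_segmentIntegral hφ hφc e hT0]
      by_cases hx : x ∈ tsupport χ
      · have hzero : φ (x - T • e) = 0 := by
          refine image_eq_zero_of_notMem_tsupport fun hm => ?_
          have h1 := (hφs hm).2
          have h2 := hχs hx
          have h3 : dist x (x - T • e) = 2 * r := by
            rw [dist_eq_norm, sub_sub_cancel, norm_smul, Real.norm_of_nonneg hT0, hT]
            field_simp
          have h4 := dist_triangle_right x (x - T • e) x₀
          rw [Metric.mem_ball] at h1 h2
          linarith
        rw [hzero, sub_zero]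
      · simp [image_eq_zero_of_notMem_tsupport hx]
    have hdir := h.directional hv hg e hθC hθc hθs
    simp only [hD] at hdir
    have hψ0 : Continuous ψ := hψC.continuous
    have hψc : ∀ f : E d → ℝ, HasCompactSupport f → HasCompactSupport fun x => ψ x * f x :=
      fun f hf => hf.mul_left
    have e1 : ∫ x in Ω, ((χ x * φ x + ψ x * fderiv ℝ χ x e : ℝ) : ℂ) * v x
        = (∫ x in Ω, (φ x : ℂ) * ((χ x : ℂ) * v x))
          + ∫ x in Ω, ((ψ x * fderiv ℝ χ x e : ℝ) : ℂ) * v x := by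
      rw [← integral_add]
      · refine integral_congr_ae (Eventually.of_forall fun x => ?_)
        simp only
        push_cast
        ring
      · exact integrable_bounded_mul hφ.continuous hφc
          (integrable_bounded_mul hχ.continuous hχc hv)
      · exact integrable_bounded_mul (hψ0.mul (continuous_partial hχ e))
          (hψc _ (hasCompactSupport_partial hχc e)) hv
    have e2 : ∫ x in Ω, (ψ x : ℂ) * cutoffDeriv χ v g e x
        = (∫ x in Ω, ((ψ x * fderiv ℝ χ x e : ℝ) : ℂ) * v x)
          + ∫ x in Ω, ((χ x * ψ x : ℝ) : ℂ) * dirComp e (g x) := by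
      rw [← integral_add]
      · refine integral_congr_ae (Eventually.of_forall fun x => ?_)
        simp only [cutoffDeriv]
        push_cast
        ring
      · exact integrable_bounded_mul (hψ0.mul (continuous_partial hχ e))
          (hψc _ (hasCompactSupport_partial hχc e)) hv
      · exact integrable_bounded_mul (hχ.continuous.mul hψ0) hθc (integrableOn_dirComp hg e)
    have e3 : ∫ x in Ω, (φ x : ℂ) * ((χ x : ℂ) * v x)
        = - ∫ x in Ω, (ψ x : ℂ) * cutoffDeriv χ v g e x := by
      rw [e2]
      rw [e1] at hdir
      rw [← sub_eq_zero, ← sub_eq_zero.2 hdir]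
      ring
    have e4 : ∫ x in Ω, (φ x : ℂ) * ((χ x : ℂ) * v x)
        = ∫ x, φ x • Ω.indicator (fun y => (χ y : ℂ) * v y) x := by
      rw [← integral_indicator hΩ.measurableSet]
      congr 1
      ext x
      by_cases hx : x ∈ Ω <;> simp [hx]
    have e5 : ∫ x in Ω, (ψ x : ℂ) * cutoffDeriv χ v g e x = ∫ x, ψ x • H x := by
      rw [← integral_indicator hΩ.measurableSet]
      congr 1
      ext x
      by_cases hx : x ∈ Ω <;> simp [hx, hH]
    obtain ⟨Cφ, hCφ⟩ := hφ.continuous.bounded_above_of_compact_support hφc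
    have hφ0 := hφ.continuous
    -- Fubini and a translation by `t • e` move the segment average from the test function to `H`.
    have e6 : ∫ x, ψ x • H x = ∫ y, φ y • J y := by
      have i1 : Integrable (fun p : ℝ × E d => φ (p.2 - p.1 • e) • H p.2)
          ((volume.restrict (Ioc 0 T)).prod volume) :=
        (hHi.comp_snd _).bdd_smul Cφ (Continuous.aestronglyMeasurable (by fun_prop))
          (Eventually.of_forall fun p => hCφ _)
      have i2 : Integrable (fun p : ℝ × E d => φ p.2 • H (p.2 + p.1 • e))
          ((volume.restrict (Ioc 0 T)).prod volume) :=
        hsh.bdd_smul Cφ (Continuous.aestronglyMeasurable (by fun_prop))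
          (Eventually.of_forall fun p => hCφ _)
      calc ∫ x, ψ x • H x = ∫ x, ∫ t in Ioc 0 T, φ (x - t • e) • H x := by
            congr 1
            ext x
            rw [hψ, segmentIntegral, intervalIntegral.integral_of_le hT0, integral_smul_const]
        _ = ∫ t in Ioc 0 T, ∫ x, φ (x - t • e) • H x := (integral_integral_swap i1).symm
        _ = ∫ t in Ioc 0 T, ∫ y, φ y • H (y + t • e) := by
            congr 1
            ext t
            rw [← integral_add_right_eq_self _ (t • e)]
            simp
        _ = ∫ y, ∫ t in Ioc 0 T, φ y • H (y + t • e) := integral_integral_swap i2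
        _ = ∫ y, φ y • J y := by
            congr 1
            ext y
            rw [integral_smul]
    have i3 : Integrable fun y => φ y • Ω.indicator (fun y => (χ y : ℂ) * v y) y :=
      hχv.bdd_smul Cφ hφ0.aestronglyMeasurable (Eventually.of_forall hCφ)
    have i4 : Integrable fun y => φ y • J y :=
      hJi.bdd_smul Cφ hφ0.aestronglyMeasurable (Eventually.of_forall hCφ)
    simp only [smul_add]
    rw [integral_add i3 i4, ← e4, e3, e5, e6, neg_add_cancel]

end Rays


/-! ### The Gagliardo inequality, first for lines and then in a Lipschitz domain. -/

section Gagliardo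

variable {d : ℕ} {Ω : Set (E d)}

/-- The Gagliardo inequality along the lines parallel to the vectors of an arbitrary basis. -/
theorem lintegral_rpow_le_of_le_lines {p : ℝ} (hp : Real.HolderConjugate (d : ℝ) p)
    (b : Module.Basis (Fin d) ℝ (E d)) :
    ∃ C : ℝ≥0, ∀ (w f : E d → ℝ≥0∞), Measurable f →
      (∀ j, ∀ᵐ y, w y ≤ ∫⁻ t : ℝ, f (y + t • b j)) →
      ∫⁻ y, w y ^ p ≤ C * (∫⁻ y, f y) ^ p := by
  -- In the coordinates of `b` the lines become parallel to the axes. The change of variables costs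
  -- only the two Haar scalar factors `c` and `c'`.
  let Φ : (Fin d → ℝ) ≃L[ℝ] E d := b.equivFun.symm.toContinuousLinearEquiv
  let m : (Fin d → ℝ) ≃ᵐ E d := Φ.toHomeomorph.toMeasurableEquiv
  let μ : Measure (E d) := (volume : Measure (Fin d → ℝ)).map m
  have hμ : μ.IsAddHaarMeasure :=
    Φ.isAddHaarMeasure_map (volume : Measure (Fin d → ℝ))
  set c : ℝ≥0 := Measure.addHaarScalarFactor (volume : Measure (E d)) μ with hc
  set c' : ℝ≥0 := Measure.addHaarScalarFactor μ (volume : Measure (E d)) with hc'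
  have h1 : (volume : Measure (E d)) = c • μ := Measure.isAddLeftInvariant_eq_smul _ _
  have h2 : μ = c' • (volume : Measure (E d)) := Measure.isAddLeftInvariant_eq_smul _ _
  have hp0 : 0 ≤ p := hp.symm.nonneg
  have hd1 : (1 : ℝ) < d := hp.lt
  refine ⟨c * c' ^ p, fun w f hf hwf => ?_⟩
  have hline : ∀ j, ∀ᵐ z : Fin d → ℝ,
      w (m z) ≤ ∫⁻ s : ℝ, f (m (Function.update z j s)) := by
    intro j
    have h3 : ∀ᵐ y ∂μ, w y ≤ ∫⁻ t : ℝ, f (y + t • b j) := by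
      rw [h2]
      exact Measure.ae_smul_measure (hwf j) c'
    have h4 := ae_of_ae_map m.measurable.aemeasurable h3
    filter_upwards [h4] with z hz
    refine hz.trans (le_of_eq ?_)
    rw [← lintegral_sub_right_eq_self _ (z j)]
    refine lintegral_congr fun s => ?_
    congr 1
    have e1 : Function.update z j s = z + (s - z j) • Pi.single j (1 : ℝ) := by
      ext i
      by_cases hi : i = j
      · subst hi
        simp
      · simp [hi]
    have e2 : Φ (Pi.single j (1 : ℝ)) = b j := by
      simp [Φ, Module.Basis.equivFun_symm_apply, Pi.single_apply]
    change Φ z + (s - z j) • b j = Φ (Function.update z j s)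
    rw [e1, map_add, map_smul, e2]
  -- This bounds the integral of a product of `d` line integrals, each to the power `1/(d-1)`. Since
  -- `p = d/(d-1)`, the function `w ^ p` splits into `d` such factors, one for each direction.
  have hgrid := lintegral_prod_lintegral_pow_le (fun _ : Fin d => (volume : Measure ℝ))
    (p := p) (by simpa using hp) (hf.comp m.measurable)
  rw [← volume_pi] at hgrid
  have hpe : 1 / ((d : ℝ) - 1) * d = p := by
    rw [hp.conjugate_eq]
    ring
  calc ∫⁻ y, w y ^ p = c * ∫⁻ z, w (m z) ^ p := by
        rw [h1, lintegral_smul_measure, lintegral_map_equiv]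
        rfl
    _ ≤ c * (∫⁻ z, f (m z)) ^ p := by
        gcongr
        refine le_trans (lintegral_mono_ae ?_) hgrid
        filter_upwards [ae_all_iff.2 hline] with z hz
        calc w (m z) ^ p = ∏ _j : Fin d, w (m z) ^ (1 / ((d : ℝ) - 1)) := by
              rw [Finset.prod_const, Finset.card_univ, Fintype.card_fin, ← ENNReal.rpow_natCast,
                ← ENNReal.rpow_mul, hpe]
          _ ≤ _ := by
              rw [Fintype.card_fin]
              refine Finset.prod_le_prod' fun j _ => ?_
              refine ENNReal.rpow_le_rpow (hz j) ?_
              have : (0 : ℝ) < d - 1 := by linarith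
              positivity
    _ = c * (c' * ∫⁻ y, f y) ^ p := by
        congr 2
        rw [← lintegral_map_equiv f m]
        change ∫⁻ y, f y ∂μ = _
        rw [h2, lintegral_smul_measure]
        rfl
    _ = _ := by
        rw [ENNReal.mul_rpow_of_nonneg _ _ hp0, ← mul_assoc, ENNReal.coe_mul,
          ENNReal.coe_rpow_of_nonneg _ hp0]

/-- Near each point of the closure of a Lipschitz domain there is a basis of directions that do
not leave the domain. -/
theorem IsLipschitzDomain.exists_directions (hΩ : IsLipschitzDomain Ω) {x : E d}
    (hx : x ∈ closure Ω) :
    ∃ (r : ℝ) (b : Module.Basis (Fin d) ℝ (E d)), 0 < r ∧ ∀ j,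
      ∀ y ∈ Ω ∩ Metric.ball x r, ∀ t : ℝ, 0 ≤ t → y + t • b j ∈ Metric.ball x r →
        y + t • b j ∈ Ω := by
  by_cases hxΩ : x ∈ Ω
  · obtain ⟨r, hr, hball⟩ := Metric.isOpen_iff.1 hΩ.isOpen x hxΩ
    exact ⟨r, (EuclideanSpace.basisFun (Fin d) ℝ).toBasis, hr, fun j y _ t _ h => hball h⟩
  · have hfr : x ∈ frontier Ω := ⟨hx, by rwa [hΩ.isOpen.interior_eq]⟩
    obtain ⟨n, r, L, γ, hn, hr, hγ, hΩn⟩ := hΩ.lipschitz_boundary x hfr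
    -- The directions are tilts `c • n ± eⱼ` of the inner vertical. The signs agree with those of
    -- `n`, so that all contributions in the independence argument are nonnegative and cannot
    -- cancel.
    let s : Fin d → ℝ := fun j => if 0 ≤ n j then 1 else -1
    have hs1 : ∀ j, s j * s j = 1 := fun j => by
      simp only [s]
      split_ifs <;> norm_num
    have hsn : ∀ j, s j * n j = |n j| := fun j => by
      simp only [s]
      split_ifs with h
      · rw [abs_of_nonneg h, one_mul]
      · rw [abs_of_neg (not_le.1 h), neg_one_mul]
    -- Moving by `t • w j` shifts the horizontal projection by at most `t`, so the graph rises by at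
    -- most `L t`. The height gained is `t (c + ⟪n, eⱼ⟫) ≥ t (c - 1)`, which `c = L + 1` makes large
    -- enough.
    set c : ℝ := L + 1 with hc
    have hc0 : 0 < c := by positivity
    let e : Fin d → E d := fun j => s j • EuclideanSpace.single j 1
    let w : Fin d → E d := fun j => c • n + e j
    have hwi : ∀ j i, w j i = c * n i + s j * (if i = j then 1 else 0) := fun j i => by
      simp [w, e]
    have hlin : LinearIndependent ℝ w := by
      rw [Fintype.linearIndependent_iff]
      intro a ha
      set S : ℝ := ∑ j, a j with hS
      have hcomp : ∀ i, a i * s i = - (c * n i * S) := by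
        intro i
        have h1 := congrArg (fun z : E d => z i) ha
        simp only [WithLp.ofLp_sum, Finset.sum_apply, PiLp.smul_apply, hwi, smul_eq_mul,
          PiLp.zero_apply, mul_add, Finset.sum_add_distrib, mul_ite, mul_one, mul_zero,
          Finset.sum_ite_eq, Finset.mem_univ, if_true, ← Finset.sum_mul, ← hS] at h1
        linarith
      have hcomp' : ∀ i, a i = - (c * S) * |n i| := by
        intro i
        calc a i = a i * s i * s i := by rw [mul_assoc, hs1, mul_one]
          _ = - (c * S) * (s i * n i) := by rw [hcomp]; ring
          _ = _ := by rw [hsn]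
      -- Summing the component equations gives `S (1 + c ∑ |nᵢ|) = 0` with a positive second factor.
      have hS0 : S = 0 := by
        have h2 : S = - (c * S) * ∑ i, |n i| := by
          rw [Finset.mul_sum, hS]
          exact Finset.sum_congr rfl fun i _ => hcomp' i
        have h3 : S * (1 + c * ∑ i, |n i|) = 0 := by linear_combination h2
        have h4 : 0 < 1 + c * ∑ i, |n i| := by positivity
        exact (mul_eq_zero.1 h3).resolve_right h4.ne'
      intro i
      rw [hcomp' i, hS0]
      ring
    have hcard : Fintype.card (Fin d) = Module.finrank ℝ (E d) := by simp
    rcases isEmpty_or_nonempty (Fin d) with hemp | hne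
    · exact ⟨r, (EuclideanSpace.basisFun (Fin d) ℝ).toBasis, hr, fun j => hemp.elim j⟩
    refine ⟨r, basisOfLinearIndependentOfCardEqFinrank hlin hcard, hr, fun j y hy t ht hyt => ?_⟩
    rw [coe_basisOfLinearIndependentOfCardEqFinrank] at hyt ⊢
    have hyγ := (hΩn y hy.2).1 hy.1
    rw [hΩn _ hyt]
    set v := e j with hv
    have hvn : ‖v‖ = 1 := by
      simp only [hv, e, norm_smul, PiLp.norm_single, s]
      split_ifs <;> norm_num
    have hnn : inner ℝ n n = 1 := by rw [real_inner_self_eq_norm_sq, hn]; norm_num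
    have hinner : inner ℝ n (y + t • w j) = inner ℝ n y + t * (c + inner ℝ n v) := by
      simp only [w, ← hv, inner_add_right, inner_smul_right, hnn]
      ring
    have hnv : -1 ≤ inner ℝ n v := by
      have := abs_real_inner_le_norm n v
      rw [hn, hvn, one_mul] at this
      exact (abs_le.1 this).1
    have hproj : ‖v - inner ℝ n v • n‖ ≤ 1 := by
      have h1 : ‖v - inner ℝ n v • n‖ ^ 2 = 1 - inner ℝ n v ^ 2 := by
        rw [norm_sub_sq_real, hvn, norm_smul, hn, inner_smul_right, real_inner_comm,
          Real.norm_eq_abs, mul_one, sq_abs]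
        ring
      nlinarith [norm_nonneg (v - inner ℝ n v • n), sq_nonneg (inner ℝ n v)]
    have hdist : dist (y + t • w j - inner ℝ n (y + t • w j) • n) (y - inner ℝ n y • n) ≤ t := by
      have e1 : y + t • w j - inner ℝ n (y + t • w j) • n - (y - inner ℝ n y • n)
          = t • (v - inner ℝ n v • n) := by
        rw [hinner]
        simp only [w, ← hv]
        module
      rw [dist_eq_norm, e1, norm_smul, Real.norm_of_nonneg ht]
      exact mul_le_of_le_one_right ht hproj
    have hγd := hγ.dist_le_mul (y + t • w j - inner ℝ n (y + t • w j) • n) (y - inner ℝ n y • n)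
    have hγl : γ (y + t • w j - inner ℝ n (y + t • w j) • n)
        ≤ γ (y - inner ℝ n y • n) + L * t := by
      have h1 := (le_abs_self _).trans ((Real.dist_eq _ _).symm.le.trans hγd)
      have h2 := mul_le_mul_of_nonneg_left hdist L.coe_nonneg
      linarith
    have : L * t ≤ t * (c + inner ℝ n v) := by
      rw [mul_comm]
      refine mul_le_mul_of_nonneg_left ?_ ht
      rw [hc]
      linarith
    rw [hinner] at hγl ⊢
    linarith

/-- With a cutoff equal to one on the half ball, the ray estimate holds in every direction of the
adapted basis. All directional derivatives are dominated by one multiple of `‖v‖ + ‖g‖`, extended by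
zero outside `Ω`, so the inequality for lines applies. -/
theorem IsLipschitzDomain.exists_local_gagliardo (hΩ : IsLipschitzDomain Ω) {p : ℝ}
    (hp : Real.HolderConjugate (d : ℝ) p) {x₀ : E d} (hx : x₀ ∈ closure Ω) :
    ∃ (r : ℝ) (C : ℝ≥0), 0 < r ∧ ∀ (v : E d → ℂ) (g : E d → EuclideanSpace ℂ (Fin d)),
      Measurable v → Measurable g → IntegrableOn v Ω → IntegrableOn g Ω → IsWeakGrad Ω v g →
      ∫⁻ y in Ω ∩ Metric.ball x₀ r, ‖v y‖ₑ ^ p ≤ C * (∫⁻ y in Ω, (‖v y‖ₑ + ‖g y‖ₑ)) ^ p := by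
  obtain ⟨r, b, hr, hray⟩ := hΩ.exists_directions hx
  obtain ⟨C, hC⟩ := lintegral_rpow_le_of_le_lines hp b
  have hp0 : 0 ≤ p := hp.symm.nonneg
  let β : ContDiffBump x₀ := ⟨r / 2, 3 * r / 4, by positivity, by linarith⟩
  let χ : E d → ℝ := β
  have hχ : ContDiff ℝ ∞ χ := β.contDiff
  have hχc : HasCompactSupport χ := β.hasCompactSupport
  have hχs : tsupport χ ⊆ Metric.ball x₀ r := by
    rw [β.tsupport_eq]
    exact Metric.closedBall_subset_ball (by change 3 * r / 4 < r; linarith)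
  have hMj : ∀ j, ∃ M, ∀ x, ‖fderiv ℝ χ x (b j)‖ ≤ M := fun j =>
    (continuous_partial hχ (b j)).bounded_above_of_compact_support
      (hasCompactSupport_partial hχc (b j))
  choose M hM using hMj
  let K : ℝ := ∑ j, (|M j| + ∑ i, ‖b j i‖)
  have hKj : ∀ j, |M j| + ∑ i, ‖b j i‖ ≤ K := fun j =>
    Finset.single_le_sum (f := fun j => |M j| + ∑ i, ‖b j i‖)
      (fun j _ => by positivity) (Finset.mem_univ j)
  have hK0 : 0 ≤ K := Finset.sum_nonneg fun j _ => by positivity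
  refine ⟨r / 2, C * K.toNNReal ^ p, by positivity, fun v g hvm hgm hv hg h => ?_⟩
  let f : E d → ℝ≥0∞ := Ω.indicator fun y => ENNReal.ofReal K * (‖v y‖ₑ + ‖g y‖ₑ)
  have hfm : Measurable f :=
    (measurable_const.mul (hvm.enorm.add hgm.enorm)).indicator hΩ.isOpen.measurableSet
  have hmain := hC (Ω.indicator fun y => ‖(χ y : ℂ) * v y‖ₑ) f hfm fun j => by
    filter_upwards [h.enorm_cutoff_le_lintegral_ray hΩ.isOpen hv hg (b.ne_zero j) (hray j) hχ hχc
      hχs] with y hy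
    by_cases hyΩ : y ∈ Ω
    · rw [indicator_of_mem hyΩ]
      refine (hy hyΩ).trans (lintegral_mono fun t => ?_)
      set z := y + t • b j
      by_cases hz : z ∈ Ω
      · simp only [f, indicator_of_mem hz]
        rw [← ofReal_norm, ← ofReal_norm, ← ofReal_norm,
          ← ENNReal.ofReal_add (norm_nonneg _) (norm_nonneg _), ← ENNReal.ofReal_mul hK0]
        refine ENNReal.ofReal_le_ofReal ?_
        rw [cutoffDeriv]
        refine (norm_add_le _ _).trans ?_
        rw [norm_mul, norm_mul, Complex.norm_real, Complex.norm_real, mul_add]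
        have hχ1 : ‖χ z‖ ≤ 1 := by
          rw [Real.norm_of_nonneg β.nonneg]
          exact β.le_one
        have h1 : ‖fderiv ℝ χ z (b j)‖ ≤ K := by
          refine (hM j z).trans ((le_abs_self _).trans (le_trans ?_ (hKj j)))
          exact le_add_of_nonneg_right (by positivity)
        have h2 : ‖dirComp (b j) (g z)‖ ≤ K * ‖g z‖ := by
          refine (norm_dirComp_le _ _).trans (mul_le_mul_of_nonneg_right ?_ (norm_nonneg _))
          exact le_trans (le_add_of_nonneg_left (abs_nonneg _)) (hKj j)
        refine add_le_add (mul_le_mul_of_nonneg_right h1 (norm_nonneg _)) ?_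
        exact (mul_le_of_le_one_left (norm_nonneg _) hχ1).trans h2
      · simp [hz]
    · rw [indicator_of_notMem hyΩ]
      exact zero_le
  calc ∫⁻ y in Ω ∩ Metric.ball x₀ (r / 2), ‖v y‖ₑ ^ p
      = ∫⁻ y in Ω ∩ Metric.ball x₀ (r / 2), (Ω.indicator (fun y => ‖(χ y : ℂ) * v y‖ₑ) y) ^ p := by
        refine setLIntegral_congr_fun
          (hΩ.isOpen.measurableSet.inter measurableSet_ball) fun y hy => ?_
        have h1 : χ y = 1 := β.one_of_mem_closedBall (Metric.ball_subset_closedBall hy.2)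
        simp [hy.1, h1]
    _ ≤ _ := setLIntegral_le_lintegral _ _
    _ ≤ _ := hmain
    _ = _ := by
        simp only [f]
        rw [lintegral_indicator hΩ.isOpen.measurableSet,
          lintegral_const_mul' _ _ ENNReal.ofReal_ne_top, ENNReal.mul_rpow_of_nonneg _ _ hp0,
          ← mul_assoc, ENNReal.coe_mul, ENNReal.coe_rpow_of_nonneg _ hp0]
        rfl

theorem lintegral_biUnion_finset_le {α ι : Type*} [MeasurableSpace α] {μ : Measure α}
    (s : Finset ι) (t : ι → Set α) (f : α → ℝ≥0∞) :
    ∫⁻ a in ⋃ i ∈ s, t i, f a ∂μ ≤ ∑ i ∈ s, ∫⁻ a in t i, f a ∂μ := by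
  classical
  induction s using Finset.induction_on with
  | empty => simp
  | insert i s hi ih =>
    rw [Finset.set_biUnion_insert, Finset.sum_insert hi]
    exact (lintegral_union_le _ _ _).trans (add_le_add le_rfl ih)

/-- The Gagliardo inequality in a bounded Lipschitz domain. -/
theorem IsLipschitzDomain.exists_gagliardo (hΩ : IsLipschitzDomain Ω) {p : ℝ}
    (hp : Real.HolderConjugate (d : ℝ) p) :
    ∃ C : ℝ≥0, ∀ (v : E d → ℂ) (g : E d → EuclideanSpace ℂ (Fin d)),
      Measurable v → Measurable g → IntegrableOn v Ω → IntegrableOn g Ω → IsWeakGrad Ω v g →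
      ∫⁻ y in Ω, ‖v y‖ₑ ^ p ≤ C * (∫⁻ y in Ω, (‖v y‖ₑ + ‖g y‖ₑ)) ^ p := by
  choose! r C hr hC using fun x (hx : x ∈ closure Ω) => hΩ.exists_local_gagliardo hp hx
  have hcpt : IsCompact (closure Ω) := hΩ.isBounded.isCompact_closure
  -- Compactness of the closure reduces the global bound to finitely many local ones. No extension
  -- across the boundary is needed.
  obtain ⟨s, hs, hcov⟩ := hcpt.elim_nhds_subcover (fun x => Metric.ball x (r x))
    fun x hx => Metric.ball_mem_nhds x (hr x hx)
  refine ⟨∑ x ∈ s, C x, fun v g hvm hgm hv hg h => ?_⟩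
  have hsub : Ω ⊆ ⋃ x ∈ s, Ω ∩ Metric.ball x (r x) := by
    intro y hy
    have := hcov (subset_closure hy)
    simp only [mem_iUnion] at this ⊢
    obtain ⟨x, hx, hxy⟩ := this
    exact ⟨x, hx, hy, hxy⟩
  calc ∫⁻ y in Ω, ‖v y‖ₑ ^ p ≤ ∫⁻ y in ⋃ x ∈ s, Ω ∩ Metric.ball x (r x), ‖v y‖ₑ ^ p :=
        lintegral_mono_set hsub
    _ ≤ ∑ x ∈ s, ∫⁻ y in Ω ∩ Metric.ball x (r x), ‖v y‖ₑ ^ p :=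
        lintegral_biUnion_finset_le _ _ _
    _ ≤ ∑ x ∈ s, C x * (∫⁻ y in Ω, (‖v y‖ₑ + ‖g y‖ₑ)) ^ p :=
        Finset.sum_le_sum fun x hx => hC x (hs x hx) v g hvm hgm hv hg h
    _ = _ := by
        rw [← Finset.sum_mul, ENNReal.ofNNReal_finsetSum]

end Gagliardo


/-! ### Bounded smooth substitutes for powers of the modulus. -/

section TruncatedPower

/-- The modulus, smoothly truncated at height `ε ^ (-1/2)`. -/
noncomputable def truncAbs (ε : ℝ) (z : ℂ) : ℝ := ‖z‖ / √(1 + ε * ‖z‖ ^ 2)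

/-- The even power of exponent `2 * k + 2` of the truncated modulus. -/
noncomputable def truncPow (ε : ℝ) (k : ℕ) (z : ℂ) : ℂ :=
  (((‖z‖ ^ 2 / (1 + ε * ‖z‖ ^ 2)) ^ (k + 1) : ℝ) : ℂ)

variable {ε : ℝ} (hε : 0 < ε) (k : ℕ) (z : ℂ)
include hε

theorem truncAbs_den_pos : 0 < 1 + ε * ‖z‖ ^ 2 := by positivity

theorem truncAbs_sq : truncAbs ε z ^ 2 = ‖z‖ ^ 2 / (1 + ε * ‖z‖ ^ 2) := by
  rw [truncAbs, div_pow, Real.sq_sqrt (truncAbs_den_pos hε z).le]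

theorem truncAbs_nonneg : 0 ≤ truncAbs ε z := by
  unfold truncAbs
  positivity

theorem truncAbs_le : truncAbs ε z ≤ ‖z‖ := by
  refine div_le_self (norm_nonneg _) (Real.one_le_sqrt.2 ?_)
  have : 0 ≤ ε * ‖z‖ ^ 2 := by positivity
  linarith

theorem truncAbs_le_const : truncAbs ε z ≤ √(1 / ε) := by
  refine Real.le_sqrt_of_sq_le ?_
  rw [truncAbs_sq hε, div_le_div_iff₀ (truncAbs_den_pos hε z) hε]
  linarith

theorem continuous_truncAbs : Continuous (truncAbs ε) := by
  unfold truncAbs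
  refine continuous_norm.div (by fun_prop) fun z => ?_
  exact (Real.sqrt_pos.2 (truncAbs_den_pos hε z)).ne'

theorem norm_truncPow : ‖truncPow ε k z‖ = truncAbs ε z ^ (2 * k + 2) := by
  rw [truncPow, Complex.norm_real, Real.norm_of_nonneg (by positivity), ← truncAbs_sq hε,
    ← pow_mul]
  ring_nf

theorem contDiff_truncPow : ContDiff ℝ 1 (truncPow ε k) := by
  have h1 : ContDiff ℝ 1 fun z : ℂ => ‖z‖ ^ 2 := contDiff_norm_sq ℝ
  have h2 : ContDiff ℝ 1 fun z : ℂ => (‖z‖ ^ 2 / (1 + ε * ‖z‖ ^ 2)) ^ (k + 1) :=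
    (h1.div (contDiff_const.add (contDiff_const.mul h1))
      fun z => (truncAbs_den_pos hε z).ne').pow _
  exact Complex.ofRealCLM.contDiff.comp h2

/-- As `s / (1 + ε s)` has derivative `1 / (1 + ε s)²`, the inner derivative contributes `‖z‖ / (1 +
ε ‖z‖²)²`, which is below the truncated modulus itself. The bound thus has the form expected for a
pure power, with a constant independent of `ε`. -/
theorem norm_fderiv_truncPow_le :
    ‖fderiv ℝ (truncPow ε k) z‖ ≤ 2 * (k + 1) * truncAbs ε z ^ (2 * k + 1) := by
  set s := ‖z‖ ^ 2 with hs
  have hden := truncAbs_den_pos hε z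
  have hf : HasDerivAt (fun s : ℝ => s / (1 + ε * s)) (1 / (1 + ε * s) ^ 2) s := by
    have h1 : HasDerivAt (fun s : ℝ => 1 + ε * s) ε s := by
      simpa using ((hasDerivAt_id s).const_mul ε).const_add 1
    refine ((hasDerivAt_id' s).div h1 hden.ne').congr_deriv ?_
    ring
  have hF := hf.pow (k + 1)
  have hN : HasFDerivAt (fun z : ℂ => ‖z‖ ^ 2) (2 • innerSL ℝ z) z :=
    (hasStrictFDerivAt_norm_sq z).hasFDerivAt
  have hq := Complex.ofRealCLM.hasFDerivAt.comp z (hF.comp_hasFDerivAt z hN)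
  have hq' : HasFDerivAt (truncPow ε k) _ z := hq
  rw [hq'.fderiv]
  refine opNorm_le_bound _ (by have := truncAbs_nonneg hε z; positivity) fun y => ?_
  have hT0 := truncAbs_nonneg hε z
  have hT : ‖z‖ / (1 + ε * s) ^ 2 ≤ truncAbs ε z := by
    rw [truncAbs]
    refine div_le_div_of_nonneg_left (norm_nonneg _) (Real.sqrt_pos.2 hden) ?_
    have h1 : 1 ≤ 1 + ε * s := by
      have : 0 ≤ ε * s := by positivity
      linarith
    calc √(1 + ε * ‖z‖ ^ 2) ≤ √((1 + ε * s) ^ 2) := Real.sqrt_le_sqrt (by nlinarith)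
      _ = 1 + ε * s := Real.sqrt_sq hden.le
      _ ≤ (1 + ε * s) ^ 2 := by nlinarith
  have hy : |inner ℝ z y| ≤ ‖z‖ * ‖y‖ := abs_real_inner_le_norm z y
  simp only [coe_comp, Function.comp_apply, smul_apply, innerSL_apply_apply,
    Complex.ofRealCLM_apply, Complex.norm_real, smul_eq_mul, norm_mul, nsmul_eq_mul,
    Real.norm_eq_abs, add_tsub_cancel_right]
  rw [← truncAbs_sq hε, abs_of_nonneg (by positivity : (0:ℝ) ≤ 1 / (1 + ε * s) ^ 2),
    abs_of_nonneg (by positivity : (0:ℝ) ≤ (truncAbs ε z ^ 2) ^ k)]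
  push_cast
  rw [abs_of_nonneg (by positivity : (0:ℝ) ≤ (k:ℝ) + 1), abs_of_nonneg (by norm_num : (0:ℝ) ≤ 2)]
  calc ((k:ℝ) + 1) * (truncAbs ε z ^ 2) ^ k * (1 / (1 + ε * s) ^ 2) * (2 * |inner ℝ z y|)
      ≤ ((k:ℝ) + 1) * (truncAbs ε z ^ 2) ^ k * (1 / (1 + ε * s) ^ 2) * (2 * (‖z‖ * ‖y‖)) := by
        gcongr
    _ = 2 * ((k:ℝ) + 1) * (truncAbs ε z ^ 2) ^ k * (‖z‖ / (1 + ε * s) ^ 2) * ‖y‖ := by ring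
    _ ≤ 2 * ((k:ℝ) + 1) * (truncAbs ε z ^ 2) ^ k * truncAbs ε z * ‖y‖ := by gcongr
    _ = _ := by ring

omit hε in
theorem tendsto_truncAbs :
    Tendsto (fun n : ℕ => truncAbs (1 / ((n : ℝ) + 1)) z) atTop (𝓝 ‖z‖) := by
  have h1 : Tendsto (fun n : ℕ => √(1 + 1 / ((n : ℝ) + 1) * ‖z‖ ^ 2)) atTop (𝓝 1) := by
    have := ((tendsto_one_div_add_atTop_nhds_zero_nat (𝕜 := ℝ)).mul_const (‖z‖ ^ 2)).const_add 1
    simpa using this.sqrt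
  have h2 := (tendsto_const_nhds (x := ‖z‖)).div h1 one_ne_zero
  rw [div_one] at h2
  exact h2

end TruncatedPower

/-! ### The Gagliardo–Nirenberg inequality for the `L⁴` norm. -/

section Interpolation

variable {d : ℕ} {Ω : Set (E d)}

theorem norm_toLp_map_le (A : ℂ →L[ℝ] ℂ) (z : EuclideanSpace ℂ (Fin d)) :
    ‖(WithLp.toLp 2 fun i => A (z i) : EuclideanSpace ℂ (Fin d))‖ ≤ ‖A‖ * ‖z‖ := by
  rw [EuclideanSpace.norm_eq, EuclideanSpace.norm_eq]
  refine Real.sqrt_le_iff.2 ⟨by positivity, ?_⟩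
  rw [mul_pow, Real.sq_sqrt (by positivity), Finset.mul_sum]
  refine Finset.sum_le_sum fun i _ => ?_
  rw [← mul_pow]
  exact pow_le_pow_left₀ (norm_nonneg _) (A.le_opNorm _) 2

theorem measurable_toLp_map {f : E d → ℂ →L[ℝ] ℂ} (hf : Measurable f)
    {g : E d → EuclideanSpace ℂ (Fin d)} (hg : Measurable g) :
    Measurable fun x => (WithLp.toLp 2 fun i => f x (g x i) : EuclideanSpace ℂ (Fin d)) := by
  refine (WithLp.measurable_toLp 2 _).comp (measurable_pi_lambda _ fun i => ?_)
  have hgi : Measurable fun x => g x i :=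
    (EuclideanSpace.proj (𝕜 := ℂ) i).continuous.measurable.comp hg
  exact isBoundedBilinearMap_apply.continuous.measurable.comp (hf.prodMk hgi)

theorem IsLipschitzDomain.volume_lt_top (hΩ : IsLipschitzDomain Ω) : volume Ω < ⊤ :=
  hΩ.isBounded.measure_lt_top

/-- The Gagliardo inequality is applied to a truncated even power of `|v|`. Truncation makes the
chain rule applicable. The bound `M` on the derivative depends on `ε` but serves only for
integrability, while the final constant does not depend on `ε`. -/
theorem IsLipschitzDomain.exists_gagliardo_truncPow (hΩ : IsLipschitzDomain Ω) {p : ℝ}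
    (hp : Real.HolderConjugate (d : ℝ) p) (k : ℕ) :
    ∃ C : ℝ≥0, ∀ (v : E d → ℂ) (g : E d → EuclideanSpace ℂ (Fin d)),
      Measurable v → Measurable g → IntegrableOn v Ω → IntegrableOn g Ω → IsWeakGrad Ω v g →
      ∀ ε : ℝ, 0 < ε →
      ∫⁻ y in Ω, (ENNReal.ofReal (truncAbs ε (v y)) ^ (2 * k + 2)) ^ p ≤
        C * (∫⁻ y in Ω, ENNReal.ofReal (truncAbs ε (v y)) ^ (2 * k + 1)
          * (‖v y‖ₑ + ‖g y‖ₑ)) ^ p := by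
  obtain ⟨C, hC⟩ := hΩ.exists_gagliardo hp
  have hp0 : 0 ≤ p := hp.symm.nonneg
  set N : ℝ≥0 := 2 * (k + 1) with hN
  refine ⟨C * N ^ p, fun v g hvm hgm hv hg h ε hε => ?_⟩
  have hG := contDiff_truncPow hε k
  have hGm : Measurable fun y => truncPow ε k (v y) := hG.continuous.measurable.comp hvm
  have hDm : Measurable fun y => (WithLp.toLp 2 fun i =>
      fderiv ℝ (truncPow ε k) (v y) (g y i) : EuclideanSpace ℂ (Fin d)) :=
    measurable_toLp_map ((hG.continuous_fderiv one_ne_zero).measurable.comp hvm) hgm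
  set M : ℝ := 2 * (k + 1) * √(1 / ε) ^ (2 * k + 1) with hM
  have hbound : ∀ z, ‖fderiv ℝ (truncPow ε k) z‖ ≤ M := fun z => by
    refine (norm_fderiv_truncPow_le hε k z).trans ?_
    have := truncAbs_nonneg hε z
    have := truncAbs_le_const hε z
    rw [hM]
    gcongr
  have : IsFiniteMeasure (volume.restrict Ω) := ⟨by simpa using hΩ.volume_lt_top⟩
  have i1 : IntegrableOn (fun y => truncPow ε k (v y)) Ω := by
    refine Integrable.of_bound hGm.aestronglyMeasurable (√(1 / ε) ^ (2 * k + 2))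
      (Eventually.of_forall fun y => ?_)
    rw [norm_truncPow hε]
    exact pow_le_pow_left₀ (truncAbs_nonneg hε _) (truncAbs_le_const hε _) _
  have i2 : IntegrableOn (fun y => (WithLp.toLp 2 fun i =>
      fderiv ℝ (truncPow ε k) (v y) (g y i) : EuclideanSpace ℂ (Fin d))) Ω := by
    refine (hg.norm.const_mul M).mono' hDm.aestronglyMeasurable (Eventually.of_forall fun y => ?_)
    exact (norm_toLp_map_le _ _).trans (mul_le_mul_of_nonneg_right (hbound _) (norm_nonneg _))
  have key := hC _ _ hGm hDm i1 i2 (h.comp hΩ.isOpen hv hg hG hbound)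
  have e1 : ∀ y, ‖truncPow ε k (v y)‖ₑ = ENNReal.ofReal (truncAbs ε (v y)) ^ (2 * k + 2) :=
    fun y => by
      rw [← ofReal_norm, norm_truncPow hε, ENNReal.ofReal_pow (truncAbs_nonneg hε _)]
  simp only [e1] at key
  refine key.trans ?_
  rw [ENNReal.coe_mul, mul_assoc, ENNReal.coe_rpow_of_nonneg _ hp0,
    ← ENNReal.mul_rpow_of_nonneg _ _ hp0, ← lintegral_const_mul' _ _ ENNReal.coe_ne_top]
  gcongr with y
  set τ := ENNReal.ofReal (truncAbs ε (v y)) with hτ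
  have hτv : τ ≤ ‖v y‖ₑ := by
    rw [hτ, ← ofReal_norm]
    exact ENNReal.ofReal_le_ofReal (truncAbs_le hε _)
  have h1 : (1 : ℝ≥0∞) ≤ (N : ℝ≥0∞) := by
    have : (1 : ℝ≥0) ≤ N := by
      rw [hN]
      have : (0 : ℝ≥0) ≤ k := by positivity
      calc (1 : ℝ≥0) ≤ 2 * (0 + 1) := by norm_num
        _ ≤ _ := by gcongr
    exact_mod_cast this
  have h2 : ‖(WithLp.toLp 2 fun i => fderiv ℝ (truncPow ε k) (v y) (g y i) :
      EuclideanSpace ℂ (Fin d))‖ₑ ≤ N * τ ^ (2 * k + 1) * ‖g y‖ₑ := by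
    have h3 := (norm_toLp_map_le (fderiv ℝ (truncPow ε k) (v y)) (g y)).trans
      (mul_le_mul_of_nonneg_right (norm_fderiv_truncPow_le hε k (v y)) (norm_nonneg _))
    have h4 := ENNReal.ofReal_le_ofReal h3
    rw [ofReal_norm, ENNReal.ofReal_mul' (norm_nonneg _), ofReal_norm,
      ENNReal.ofReal_mul (by positivity), ENNReal.ofReal_pow (truncAbs_nonneg hε _)] at h4
    refine h4.trans (le_of_eq ?_)
    congr 2
    rw [ENNReal.ofReal, hN]
    congr 1
    rw [Real.toNNReal_mul (by norm_num), Real.toNNReal_add (by positivity) (by norm_num)]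
    simp
  calc τ ^ (2 * k + 2) + _ ≤ N * τ ^ (2 * k + 1) * ‖v y‖ₑ + N * τ ^ (2 * k + 1) * ‖g y‖ₑ := by
        refine add_le_add ?_ h2
        calc τ ^ (2 * k + 2) = 1 * τ ^ (2 * k + 1) * τ := by ring
          _ ≤ _ := by gcongr
    _ = _ := by ring

theorem lintegral_mul_le_of_sq_le {α : Type*} [MeasurableSpace α] {μ : Measure α}
    {f g : α → ℝ≥0∞} (hf : AEMeasurable f μ) (hg : AEMeasurable g μ) :
    (∫⁻ x, f x * g x ∂μ) ^ 2 ≤ (∫⁻ x, f x ^ 2 ∂μ) * ∫⁻ x, g x ^ 2 ∂μ := by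
  have h := ENNReal.lintegral_mul_le_Lp_mul_Lq μ Real.HolderConjugate.two_two hf hg
  simp only [ENNReal.rpow_ofNat, Pi.mul_apply] at h
  calc (∫⁻ x, f x * g x ∂μ) ^ 2
      ≤ ((∫⁻ x, f x ^ 2 ∂μ) ^ (1 / (2 : ℝ)) * (∫⁻ x, g x ^ 2 ∂μ) ^ (1 / (2 : ℝ))) ^ 2 := by
        gcongr
    _ = _ := by
        rw [mul_pow, ← ENNReal.rpow_mul_natCast, ← ENNReal.rpow_mul_natCast]
        norm_num

/-- The Gagliardo--Nirenberg inequality for the `L⁴`-norm in a bounded Lipschitz domain. -/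
theorem IsLipschitzDomain.exists_gagliardo_nirenberg (hΩ : IsLipschitzDomain Ω)
    (hd : d = 2 ∨ d = 3) :
    ∃ C : ℝ≥0, ∀ (v : E d → ℂ) (g : E d → EuclideanSpace ℂ (Fin d)),
      Measurable v → Measurable g → IntegrableOn v Ω → IntegrableOn g Ω → IsWeakGrad Ω v g →
      ∀ S Y : ℝ≥0∞, Y ≠ ⊤ → ∫⁻ y in Ω, ‖v y‖ₑ ^ 2 ≤ S ^ 2 →
        ∫⁻ y in Ω, (‖v y‖ₑ + ‖g y‖ₑ) ^ 2 ≤ Y ^ 2 →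
      ∫⁻ y in Ω, ‖v y‖ₑ ^ 4 ≤ C * S ^ (4 - d) * Y ^ d := by
  -- A bound on the truncations that is uniform in `ε` passes to `v` by Fatou's lemma.
  suffices hsuff : ∃ C : ℝ≥0, ∀ (v : E d → ℂ) (g : E d → EuclideanSpace ℂ (Fin d)),
      Measurable v → Measurable g → IntegrableOn v Ω → IntegrableOn g Ω → IsWeakGrad Ω v g →
      ∀ S Y : ℝ≥0∞, Y ≠ ⊤ → ∫⁻ y in Ω, ‖v y‖ₑ ^ 2 ≤ S ^ 2 →
        ∫⁻ y in Ω, (‖v y‖ₑ + ‖g y‖ₑ) ^ 2 ≤ Y ^ 2 → ∀ ε : ℝ, 0 < ε →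
      ∫⁻ y in Ω, ENNReal.ofReal (truncAbs ε (v y)) ^ 4 ≤ C * S ^ (4 - d) * Y ^ d by
    obtain ⟨C, hC⟩ := hsuff
    refine ⟨C, fun v g hvm hgm hv hg h S Y hY hS hYv => ?_⟩
    have hlim : ∀ y, liminf (fun n : ℕ => ENNReal.ofReal (truncAbs (1 / ((n : ℝ) + 1)) (v y)) ^ 4)
        atTop = ‖v y‖ₑ ^ 4 := fun y => by
      rw [← ofReal_norm]
      exact (((ENNReal.continuous_pow 4).tendsto _).comp
        (ENNReal.tendsto_ofReal (tendsto_truncAbs (v y)))).liminf_eq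
    simp only [← hlim]
    refine (lintegral_liminf_le fun n => ?_).trans ?_
    · exact (((continuous_truncAbs (by positivity)).measurable.comp hvm).ennreal_ofReal).pow_const 4
    · refine liminf_le_of_frequently_le' (Frequently.of_forall fun n => ?_)
      exact hC v g hvm hgm hv hg h S Y hY hS hYv _ (by positivity)
  have hτm : ∀ (v : E d → ℂ), Measurable v → ∀ ε : ℝ, 0 < ε →
      Measurable fun y => ENNReal.ofReal (truncAbs ε (v y)) := fun v hv ε hε =>
    ((continuous_truncAbs hε).measurable.comp hv).ennreal_ofReal
  have hτ2 : ∀ (v : E d → ℂ) (S : ℝ≥0∞), ∫⁻ y in Ω, ‖v y‖ₑ ^ 2 ≤ S ^ 2 → ∀ ε : ℝ, 0 < ε →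
      ∫⁻ y in Ω, ENNReal.ofReal (truncAbs ε (v y)) ^ 2 ≤ S ^ 2 := fun v S hS ε hε => by
    refine (lintegral_mono fun y => ?_).trans hS
    dsimp only
    gcongr
    rw [← ofReal_norm]
    exact ENNReal.ofReal_le_ofReal (truncAbs_le hε _)
  rcases hd with rfl | rfl
  -- In the plane the squared modulus suffices: its `L²` norm is controlled by `∫ τ (|v| + |g|)`,
  -- and Cauchy–Schwarz finishes.
  · obtain ⟨C, hC⟩ := hΩ.exists_gagliardo_truncPow (p := 2)
      (by exact_mod_cast Real.HolderConjugate.two_two) 0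
    refine ⟨C, fun v g hvm hgm hv hg h S Y hY hS hYv ε hε => ?_⟩
    have h1 := hC v g hvm hgm hv hg h ε hε
    have hm := hτm v hvm ε hε
    have hK : Measurable fun y => ‖v y‖ₑ + ‖g y‖ₑ := hvm.enorm.add hgm.enorm
    simp only [mul_zero, zero_add, pow_one, ENNReal.rpow_ofNat, ← pow_mul] at h1
    norm_num at h1
    refine h1.trans ?_
    rw [mul_assoc]
    gcongr
    refine (lintegral_mul_le_of_sq_le hm.aemeasurable hK.aemeasurable).trans ?_
    exact mul_le_mul' (hτ2 v S hS ε hε) hYv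
  · have hp : Real.HolderConjugate ((3 : ℕ) : ℝ) (3 / 2) := by
      rw [Real.holderConjugate_iff]
      norm_num
    obtain ⟨C, hC⟩ := hΩ.exists_gagliardo_truncPow hp 1
    refine ⟨C ^ 2, fun v g hvm hgm hv hg h S Y hY hS hYv ε hε => ?_⟩
    have h1 := hC v g hvm hgm hv hg h ε hε
    have hm := hτm v hvm ε hε
    have hK : Measurable fun y => ‖v y‖ₑ + ‖g y‖ₑ := hvm.enorm.add hgm.enorm
    set τ : E 3 → ℝ≥0∞ := fun y => ENNReal.ofReal (truncAbs ε (v y)) with hτ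
    set X := ∫⁻ y in Ω, τ y ^ 6 with hX
    -- In dimension three the fourth power gives `X⁴ ≤ C⁴ (X Y²)³`, where `X` occurs on both sides.
    -- The truncation makes `X` finite, so `X³` can be cancelled to obtain the Sobolev bound in
    -- `L⁶`. Cauchy–Schwarz between `L²` and `L⁶` then gives `L⁴`.
    have hXfin : X ≠ ⊤ := by
      refine (lt_of_le_of_lt (lintegral_mono (g := fun _ => ENNReal.ofReal √(1 / ε) ^ 6)
        fun y => ?_) ?_).ne
      · dsimp only [τ]
        gcongr
        exact truncAbs_le_const hε _
      · rw [lintegral_const]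
        exact ENNReal.mul_lt_top (ENNReal.pow_lt_top ENNReal.ofReal_lt_top)
          (by simpa using hΩ.volume_lt_top)
    have e1 : ∀ t : ℝ≥0∞, (t ^ 4) ^ (3 / 2 : ℝ) = t ^ 6 := fun t => by
      rw [← ENNReal.rpow_natCast, ← ENNReal.rpow_natCast, ← ENNReal.rpow_mul]
      norm_num
    norm_num [e1] at h1
    have h2 : (∫⁻ y in Ω, τ y ^ 3 * (‖v y‖ₑ + ‖g y‖ₑ)) ^ 2 ≤ X * Y ^ 2 := by
      refine (lintegral_mul_le_of_sq_le (hm.pow_const 3).aemeasurable hK.aemeasurable).trans ?_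
      simp only [← pow_mul]
      exact mul_le_mul' le_rfl hYv
    set Z := ∫⁻ y in Ω, τ y ^ 3 * (‖v y‖ₑ + ‖g y‖ₑ) with hZ
    have h3 : X ^ 4 ≤ C ^ 4 * (X * Y ^ 2) ^ 3 := by
      calc X ^ 4 ≤ (C * Z ^ (3 / 2 : ℝ)) ^ 4 := by gcongr
        _ = C ^ 4 * (Z ^ 2) ^ 3 := by
            rw [mul_pow, ← ENNReal.rpow_mul_natCast, ← pow_mul, ← ENNReal.rpow_natCast]
            norm_num
        _ ≤ _ := by gcongr
    have h4 : X ≤ C ^ 4 * Y ^ 6 := by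
      by_cases hX0 : X = 0
      · rw [hX0]
        exact zero_le
      · have hX3 : X ^ 3 ≠ 0 := pow_ne_zero _ hX0
        have hX3' : X ^ 3 ≠ ⊤ := ENNReal.pow_ne_top hXfin
        rw [← ENNReal.mul_le_mul_iff_right hX3 hX3']
        calc X ^ 3 * X = X ^ 4 := by ring
          _ ≤ _ := h3
          _ = _ := by ring
    have h5 : (∫⁻ y in Ω, τ y ^ 4) ^ 2 ≤ (C ^ 2 * S ^ 1 * Y ^ 3) ^ 2 := by
      calc (∫⁻ y in Ω, τ y ^ 4) ^ 2 = (∫⁻ y in Ω, τ y * τ y ^ 3) ^ 2 := by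
            congr 2
            ext y
            ring
        _ ≤ (∫⁻ y in Ω, τ y ^ 2) * ∫⁻ y in Ω, (τ y ^ 3) ^ 2 :=
            lintegral_mul_le_of_sq_le hm.aemeasurable (hm.pow_const 3).aemeasurable
        _ ≤ S ^ 2 * (C ^ 4 * Y ^ 6) := by
            refine mul_le_mul' (hτ2 v S hS ε hε) ?_
            simp only [← pow_mul]
            exact h4
        _ = _ := by ring
    rw [ENNReal.coe_pow]
    exact (ENNReal.pow_le_pow_left_iff two_ne_zero).1 h5

end Interpolation


/-! ### The weighted `L⁴` embedding and composition in `H¹`. -/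

section H1Facts

variable {d : ℕ} {Ω : Set (E d)}

theorem lintegral_enorm_sq_eq {F : Type*} [NormedAddCommGroup F] {α : Type*} [MeasurableSpace α]
    {μ : Measure α} (f : Lp F 2 μ) : ∫⁻ x, ‖f x‖ₑ ^ 2 ∂μ = ‖f‖ₑ ^ 2 := by
  rw [Lp.enorm_def, eLpNorm_eq_lintegral_rpow_enorm_toReal (by simp) (by simp),
    ← ENNReal.rpow_mul_natCast]
  simp

theorem measurable_fn (v : H1 Ω) : Measurable (fn v) := (Lp.stronglyMeasurable (fn v)).measurable

theorem measurable_grad (v : H1 Ω) : Measurable (grad v) :=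
  (Lp.stronglyMeasurable (grad v)).measurable

theorem h1kNorm_nonneg {κ : ℝ} (hκ : 1 ≤ κ) (v : H1 Ω) : 0 ≤ h1kNorm κ v := by
  unfold h1kNorm
  positivity

/-- The `L⁴`-norm is controlled by the weighted `H¹`-norm. -/
theorem IsLipschitzDomain.exists_l4Norm_le (hΩ : IsLipschitzDomain Ω) (hd : d = 2 ∨ d = 3) :
    ∃ B : ℝ≥0, ∀ κ : ℝ, 1 ≤ κ → ∀ v : H1 Ω,
      l4Norm v ≤ B * ENNReal.ofReal (κ ^ ((d : ℝ) / 4)) * ENNReal.ofReal (h1kNorm κ v) := by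
  obtain ⟨C, hC⟩ := hΩ.exists_gagliardo_nirenberg hd
  have : IsFiniteMeasure (volume.restrict Ω) := ⟨by simpa using hΩ.volume_lt_top⟩
  refine ⟨C + 1, fun κ hκ v => ?_⟩
  have hκ0 : 0 < κ := by linarith
  set N := h1kNorm κ v with hN
  have hN0 : 0 ≤ N := h1kNorm_nonneg hκ v
  have hfN : ‖fn v‖ ≤ N := by
    rw [hN, h1kNorm]
    exact le_add_of_nonneg_right (by positivity)
  -- The unweighted norm costs one factor `κ`. It enters the interpolation inequality to the power
  -- `d`, hence the factor `κ^{d/4}` after taking fourth roots.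
  have hgN : ‖fn v‖ + ‖grad v‖ ≤ κ * N := by
    rw [hN, h1kNorm, mul_add, mul_inv_cancel_left₀ hκ0.ne']
    gcongr
    exact le_mul_of_one_le_left (norm_nonneg _) hκ
  have hS : ∫⁻ y in Ω, ‖fn v y‖ₑ ^ 2 ≤ ENNReal.ofReal N ^ 2 := by
    rw [lintegral_enorm_sq_eq, ← ofReal_norm]
    gcongr
  have hY : ∫⁻ y in Ω, (‖fn v y‖ₑ + ‖grad v y‖ₑ) ^ 2 ≤ ENNReal.ofReal (κ * N) ^ 2 := by
    have h1 := ENNReal.lintegral_Lp_add_le (μ := volume.restrict Ω) (p := 2)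
      (measurable_fn v).enorm.aemeasurable (measurable_grad v).enorm.aemeasurable (by norm_num)
    have hhalf : ∀ t : ℝ≥0∞, (t ^ 2) ^ (1 / 2 : ℝ) = t := fun t => by
      rw [← ENNReal.rpow_natCast, ← ENNReal.rpow_mul]
      norm_num
    simp only [ENNReal.rpow_ofNat, Pi.add_apply] at h1
    rw [lintegral_enorm_sq_eq, lintegral_enorm_sq_eq, hhalf, hhalf] at h1
    calc ∫⁻ y in Ω, (‖fn v y‖ₑ + ‖grad v y‖ₑ) ^ 2
        = ((∫⁻ y in Ω, (‖fn v y‖ₑ + ‖grad v y‖ₑ) ^ 2) ^ (1 / 2 : ℝ)) ^ 2 := by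
          rw [← ENNReal.rpow_mul_natCast]
          norm_num
      _ ≤ (‖fn v‖ₑ + ‖grad v‖ₑ) ^ 2 := by gcongr
      _ ≤ _ := by
          gcongr
          rw [← ofReal_norm, ← ofReal_norm, ← ENNReal.ofReal_add (norm_nonneg _) (norm_nonneg _)]
          exact ENNReal.ofReal_le_ofReal hgN
  have hv : IntegrableOn (fn v) Ω := (Lp.memLp (fn v)).integrable one_le_two
  have hg : IntegrableOn (grad v) Ω := (Lp.memLp (grad v)).integrable one_le_two
  have key := hC (fn v) (grad v) (measurable_fn v) (measurable_grad v) hv hg v.2 _ _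
    ENNReal.ofReal_ne_top hS hY
  have h4 : l4Norm v ^ 4 = ∫⁻ y in Ω, ‖fn v y‖ₑ ^ 4 := by
    rw [l4Norm, eLpNorm_eq_lintegral_rpow_enorm_toReal (by simp) (by simp),
      ← ENNReal.rpow_mul_natCast]
    simp
  rw [← ENNReal.pow_le_pow_left_iff (by norm_num : (4 : ℕ) ≠ 0), h4]
  refine key.trans ?_
  have hκd : ENNReal.ofReal (κ ^ ((d : ℝ) / 4)) ^ 4 = ENNReal.ofReal κ ^ d := by
    rw [← ENNReal.ofReal_pow (by positivity), ← ENNReal.ofReal_pow hκ0.le,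
      ← Real.rpow_mul_natCast hκ0.le, ← Real.rpow_natCast κ d]
    norm_num
  have hdle : d ≤ 4 := by omega
  -- The constant `C + 1` replaces the fourth root of `C`.
  have hCC : (C : ℝ≥0∞) ≤ ((C + 1 : ℝ≥0) : ℝ≥0∞) ^ 4 := by
    have h1 : (C : ℝ≥0∞) ≤ ((C + 1 : ℝ≥0) : ℝ≥0∞) := by
      exact_mod_cast le_add_of_nonneg_right zero_le_one
    have h2 : (1 : ℝ≥0∞) ≤ ((C + 1 : ℝ≥0) : ℝ≥0∞) := by
      exact_mod_cast le_add_of_nonneg_left C.2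
    exact h1.trans (le_self_pow h2 (by norm_num))
  calc C * ENNReal.ofReal N ^ (4 - d) * ENNReal.ofReal (κ * N) ^ d
      = C * ENNReal.ofReal κ ^ d * (ENNReal.ofReal N ^ (4 - d) * ENNReal.ofReal N ^ d) := by
        rw [ENNReal.ofReal_mul hκ0.le, mul_pow]
        ring
    _ = C * ENNReal.ofReal κ ^ d * ENNReal.ofReal N ^ 4 := by
        rw [← pow_add, Nat.sub_add_cancel hdle]
    _ ≤ ((C + 1 : ℝ≥0) : ℝ≥0∞) ^ 4 * ENNReal.ofReal κ ^ d * ENNReal.ofReal N ^ 4 := by gcongr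
    _ = _ := by rw [mul_pow, mul_pow, hκd]

theorem memLp_four_fn (hΩ : IsLipschitzDomain Ω) (hd : d = 2 ∨ d = 3) (v : H1 Ω) :
    MemLp (fn v) 4 (volume.restrict Ω) := by
  obtain ⟨B, hB⟩ := hΩ.exists_l4Norm_le hd
  refine ⟨(Lp.memLp (fn v)).1, (hB 1 le_rfl v).trans_lt ?_⟩
  exact ENNReal.mul_lt_top (ENNReal.mul_lt_top ENNReal.coe_lt_top ENNReal.ofReal_lt_top)
    ENNReal.ofReal_lt_top

theorem IsWeakGrad.congr_ae {v v' : E d → ℂ} {g g' : E d → EuclideanSpace ℂ (Fin d)}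
    (h : IsWeakGrad Ω v g) (hv : v =ᵐ[volume.restrict Ω] v') (hg : g =ᵐ[volume.restrict Ω] g') :
    IsWeakGrad Ω v' g' := by
  intro φ hφ hc hs i
  have e1 : ∫ x in Ω, ((fderiv ℝ φ x (EuclideanSpace.single i 1) : ℝ) : ℂ) * v' x
      = ∫ x in Ω, ((fderiv ℝ φ x (EuclideanSpace.single i 1) : ℝ) : ℂ) * v x := by
    refine integral_congr_ae ?_
    filter_upwards [hv] with x hx
    rw [hx]
  have e2 : ∫ x in Ω, (φ x : ℂ) * g' x i = ∫ x in Ω, (φ x : ℂ) * g x i := by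
    refine integral_congr_ae ?_
    filter_upwards [hg] with x hx
    rw [hx]
  rw [e1, e2]
  exact h φ hφ hc hs i

/-- Composition of an `H¹`-function with a `C¹`-function of bounded derivative that fixes the
origin. -/
theorem exists_comp (hΩ : IsLipschitzDomain Ω) (u : H1 Ω) {G : ℂ → ℂ} (hG : ContDiff ℝ 1 G)
    {M : ℝ} (hM : ∀ z, ‖fderiv ℝ G z‖ ≤ M) (hG0 : G 0 = 0) :
    ∃ w : H1 Ω, (∀ᵐ x ∂(volume.restrict Ω), fn w x = G (fn u x)) ∧
      ∀ᵐ x ∂(volume.restrict Ω), ∀ j, grad w x j = fderiv ℝ G (fn u x) (grad u x j) := by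
  have : IsFiniteMeasure (volume.restrict Ω) := ⟨by simpa using hΩ.volume_lt_top⟩
  have hv : IntegrableOn (fn u) Ω := (Lp.memLp (fn u)).integrable one_le_two
  have hg : IntegrableOn (grad u) Ω := (Lp.memLp (grad u)).integrable one_le_two
  have hwk := IsWeakGrad.comp hΩ.isOpen hv hg u.2 hG hM
  have m1 : MemLp (fun x => G (fn u x)) 2 (volume.restrict Ω) := by
    refine MemLp.of_le_mul (c := M) (Lp.memLp (fn u))
      (hG.continuous.measurable.comp (measurable_fn u)).aestronglyMeasurable
      (Eventually.of_forall fun x => ?_)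
    have := convex_univ.norm_image_sub_le_of_norm_fderiv_le
      (fun x _ => (hG.differentiable one_ne_zero) x) (fun x _ => hM x) (mem_univ 0)
      (mem_univ (fn u x))
    simpa [hG0] using this
  have m2 : MemLp (fun x => (WithLp.toLp 2 fun i => fderiv ℝ G (fn u x) (grad u x i) :
      EuclideanSpace ℂ (Fin d))) 2 (volume.restrict Ω) := by
    refine MemLp.of_le_mul (c := M) (Lp.memLp (grad u))
      (measurable_toLp_map ((hG.continuous_fderiv one_ne_zero).measurable.comp (measurable_fn u))
        (measurable_grad u)).aestronglyMeasurable (Eventually.of_forall fun x => ?_)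
    exact (norm_toLp_map_le _ _).trans (mul_le_mul_of_nonneg_right (hM _) (norm_nonneg _))
  refine ⟨⟨WithLp.toLp 2 (m1.toLp _, m2.toLp _), ?_⟩, ?_, ?_⟩
  · exact hwk.congr_ae m1.coeFn_toLp.symm m2.coeFn_toLp.symm
  · exact m1.coeFn_toLp
  · filter_upwards [m2.coeFn_toLp] with x hx j
    exact congrArg (fun z : EuclideanSpace ℂ (Fin d) => z j) hx

end H1Facts

/-! ### The bound `|u| ≤ 1` for critical points. -/

section MaximumPrinciple

/-- A smooth function that vanishes on the closed unit disc and is a positive multiple of the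
identity outside. -/
noncomputable def outerPart (z : ℂ) : ℂ := Real.smoothTransition (‖z‖ ^ 2 - 1) • z

theorem contDiff_outerPart : ContDiff ℝ 1 outerPart := by
  have h1 : ContDiff ℝ ((1 : ℕ∞) : WithTop ℕ∞) Real.smoothTransition :=
    Real.smoothTransition.contDiff
  have h2 : ContDiff ℝ 1 fun z : ℂ => ‖z‖ ^ 2 - 1 := (contDiff_norm_sq ℝ).sub contDiff_const
  exact (ContDiff.comp h1 h2).smul contDiff_id

theorem fderiv_outerPart (z y : ℂ) :
    fderiv ℝ outerPart z y = Real.smoothTransition (‖z‖ ^ 2 - 1) • y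
      + (deriv Real.smoothTransition (‖z‖ ^ 2 - 1) * (2 * inner ℝ z y)) • z := by
  have h0 : Differentiable ℝ Real.smoothTransition :=
    (Real.smoothTransition.contDiff (n := 1)).differentiable one_ne_zero
  have hN : HasFDerivAt (fun z : ℂ => ‖z‖ ^ 2 - 1) (2 • innerSL ℝ z) z :=
    ((hasStrictFDerivAt_norm_sq z).hasFDerivAt).sub_const 1
  have h1 := (h0 (‖z‖ ^ 2 - 1)).hasDerivAt.comp_hasFDerivAt z hN
  have h2 : HasFDerivAt outerPart _ z := h1.smul (hasFDerivAt_id z)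
  rw [h2.fderiv]
  simp only [add_apply, smul_apply, smulRight_apply, innerSL_apply_apply, nsmul_eq_mul,
    smul_eq_mul, Nat.cast_ofNat]
  rfl

/-- The derivative of the transition function vanishes for `‖z‖² > 2`, so the quadratic growth of
the second term of the derivative matters only on a bounded set. -/
theorem exists_norm_fderiv_outerPart_le : ∃ M : ℝ, ∀ z, ‖fderiv ℝ outerPart z‖ ≤ M := by
  have hc : Continuous (deriv Real.smoothTransition) :=
    (Real.smoothTransition.contDiff (n := 1)).continuous_deriv (by simp)
  obtain ⟨K, hK⟩ := (isCompact_Icc (a := (-1 : ℝ)) (b := 1)).exists_bound_of_continuousOn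
    hc.continuousOn
  have hK0 : 0 ≤ K := (norm_nonneg _).trans (hK 0 (by norm_num))
  refine ⟨1 + 4 * K, fun z => opNorm_le_bound _ (by positivity) fun y => ?_⟩
  rw [fderiv_outerPart]
  set s := ‖z‖ ^ 2 with hs
  have hs0 : 0 ≤ s := by positivity
  have hsK : ‖deriv Real.smoothTransition (s - 1)‖ * s ≤ 2 * K := by
    by_cases h : s ≤ 2
    · have := hK (s - 1) ⟨by linarith, by linarith⟩
      nlinarith [norm_nonneg (deriv Real.smoothTransition (s - 1))]
    · have h1 : Real.smoothTransition =ᶠ[𝓝 (s - 1)] fun _ => 1 := by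
        filter_upwards [lt_mem_nhds (by linarith : (1 : ℝ) < s - 1)] with t ht
        exact Real.smoothTransition.one_of_one_le ht.le
      rw [h1.deriv_eq]
      simp [hK0]
  refine (norm_add_le _ _).trans ?_
  rw [norm_smul, norm_smul, norm_mul, norm_mul, add_mul]
  refine add_le_add ?_ ?_
  · refine mul_le_mul_of_nonneg_right ?_ (norm_nonneg _)
    rw [Real.norm_of_nonneg (Real.smoothTransition.nonneg _)]
    exact Real.smoothTransition.le_one _
  · have hy : ‖(inner ℝ z y : ℝ)‖ ≤ ‖z‖ * ‖y‖ := norm_inner_le_norm z y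
    calc ‖deriv Real.smoothTransition (s - 1)‖ * (‖(2 : ℝ)‖ * ‖(inner ℝ z y : ℝ)‖) * ‖z‖
        ≤ ‖deriv Real.smoothTransition (s - 1)‖ * (‖(2 : ℝ)‖ * (‖z‖ * ‖y‖)) * ‖z‖ := by gcongr
      _ = 2 * (‖deriv Real.smoothTransition (s - 1)‖ * s) * ‖y‖ := by
          rw [hs]
          norm_num
          ring
      _ ≤ 2 * (2 * K) * ‖y‖ := by gcongr
      _ = _ := by ring

theorem re_integral_nonneg {α : Type*} [MeasurableSpace α] {μ : Measure α} {f : α → ℂ}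
    (h : ∀ᵐ x ∂μ, 0 ≤ (f x).re) : 0 ≤ (∫ x, f x ∂μ).re := by
  by_cases hf : Integrable f μ
  · rw [← RCLike.re_eq_complex_re, ← integral_re hf]
    exact integral_nonneg_of_ae h
  · rw [integral_undef hf]
    simp

variable {d : ℕ} {Ω : Set (E d)}

/-- With `c` the covariant derivative of `a` and `r = ⟪a, b⟫`, the expression equals `p ‖c‖² + 2 q
r² / κ²`. Here `q ≥ 0` because the transition function is monotone. The magnetic part drops out of
the second term, since `a` and `i a` are orthogonal over the reals. -/
theorem re_covariant_mul_conj_nonneg {κ : ℝ} {A : ℝ} {a b : ℂ} :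
    0 ≤ ((Complex.I / (κ : ℂ) * b + (A : ℂ) * a)
      * conj (Complex.I / (κ : ℂ) * fderiv ℝ outerPart a b + (A : ℂ) * outerPart a)).re := by
  rw [fderiv_outerPart, outerPart]
  set p := Real.smoothTransition (‖a‖ ^ 2 - 1) with hp
  set q := deriv Real.smoothTransition (‖a‖ ^ 2 - 1) with hq
  have hp0 : 0 ≤ p := Real.smoothTransition.nonneg _
  have hq0 : 0 ≤ q := Real.smoothTransition.monotone.deriv_nonneg
  set r : ℝ := inner ℝ a b with hr
  have hrr : r = a.re * b.re + a.im * b.im := by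
    rw [hr, Complex.inner, Complex.mul_re, Complex.conj_re, Complex.conj_im]
    ring
  set c : ℂ := Complex.I / (κ : ℂ) * b + (A : ℂ) * a with hc
  have e1 : Complex.I / (κ : ℂ) * (p • b + (q * (2 * r)) • a) + (A : ℂ) * p • a
      = (p : ℂ) * c + ((q * (2 * r) : ℝ) : ℂ) * (Complex.I / (κ : ℂ) * a) := by
    rw [hc]
    simp only [Complex.real_smul]
    ring
  have e2 : (c * conj (Complex.I / (κ : ℂ) * a)).re = r / κ ^ 2 := by
    have h1 : Complex.I / (κ : ℂ) = ((κ⁻¹ : ℝ) : ℂ) * Complex.I := by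
      push_cast
      ring
    rw [hc, hrr, h1]
    simp [Complex.mul_re, Complex.mul_im]
    ring
  have e3 : (c * conj ((p : ℂ) * c + ((q * (2 * r) : ℝ) : ℂ) * (Complex.I / (κ : ℂ) * a))).re
      = p * ‖c‖ ^ 2 + q * (2 * r) * (r / κ ^ 2) := by
    rw [map_add, map_mul, map_mul, Complex.conj_ofReal, Complex.conj_ofReal, mul_add]
    rw [show c * ((p : ℂ) * conj c) = (p : ℂ) * (c * conj c) by ring,
      show c * (((q * (2 * r) : ℝ) : ℂ) * conj (Complex.I / (κ : ℂ) * a))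
        = ((q * (2 * r) : ℝ) : ℂ) * (c * conj (Complex.I / (κ : ℂ) * a)) by ring,
      Complex.add_re, Complex.re_ofReal_mul, Complex.re_ofReal_mul, e2, Complex.mul_conj,
      Complex.ofReal_re, Complex.normSq_eq_norm_sq]
  rw [e1, e3]
  have : q * (2 * r) * (r / κ ^ 2) = 2 * q * (r ^ 2 / κ ^ 2) := by ring
  rw [this]
  positivity

/-- Critical points of the Ginzburg--Landau energy are bounded by one. -/
theorem norm_fn_le_one (hΩ : IsLipschitzDomain Ω) (hd : d = 2 ∨ d = 3) {κ : ℝ} {A : E d → E d}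
    {u : H1 Ω} (hu : ∀ v : H1 Ω, energyD1 κ A u v = 0) :
    ∀ᵐ x ∂(volume.restrict Ω), ‖fn u x‖ ≤ 1 := by
  obtain ⟨M, hM⟩ := exists_norm_fderiv_outerPart_le
  obtain ⟨w, hw, hgw⟩ := exists_comp hΩ u contDiff_outerPart hM (by simp [outerPart])
  have h1 : 0 ≤ covForm κ A u w := by
    refine re_integral_nonneg ?_
    filter_upwards [hw, hgw] with x hx hgx
    rw [Complex.re_sum]
    refine Finset.sum_nonneg fun j _ => ?_
    simp only [covGrad, hx, hgx]
    exact re_covariant_mul_conj_nonneg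
  -- Testing with `outerPart ∘ u` makes both parts of `E'(u)` nonnegative. Their sum is zero, so the
  -- integral of `f` vanishes, and `f` is positive wherever `‖u‖ > 1`.
  let f : E d → ℝ := fun x =>
    (‖fn u x‖ ^ 2 - 1) * (Real.smoothTransition (‖fn u x‖ ^ 2 - 1) * ‖fn u x‖ ^ 2)
  have hf0 : ∀ x, 0 ≤ f x := fun x => by
    by_cases h : ‖fn u x‖ ^ 2 - 1 ≤ 0
    · simp [f, Real.smoothTransition.zero_of_nonpos h]
    · push Not at h
      have := Real.smoothTransition.nonneg (‖fn u x‖ ^ 2 - 1)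
      positivity
  have h2 : ∫ x in Ω, ((‖fn u x‖ ^ 2 - 1 : ℝ) : ℂ) * fn u x * conj (fn w x)
      = ((∫ x in Ω, f x : ℝ) : ℂ) := by
    rw [← integral_complex_ofReal]
    refine integral_congr_ae ?_
    filter_upwards [hw] with x hx
    rw [hx, outerPart, Complex.real_smul, map_mul, Complex.conj_ofReal, mul_assoc,
      mul_left_comm (fn u x), Complex.mul_conj, Complex.normSq_eq_norm_sq]
    simp [f]
  have h3 := hu w
  rw [energyD1, h2, Complex.ofReal_re] at h3
  have h4 : 0 ≤ ∫ x in Ω, f x := integral_nonneg hf0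
  have h5 : ∫ x in Ω, f x = 0 := by linarith
  have hfm : Measurable f := by
    have := (measurable_fn u).norm
    have h6 := Real.smoothTransition.continuous.measurable
    fun_prop
  have hfi : Integrable f (volume.restrict Ω) := by
    refine ((memLp_four_fn hΩ hd u).integrable_norm_pow (by norm_num)).mono'
      hfm.aestronglyMeasurable (Eventually.of_forall fun x => ?_)
    rw [Real.norm_of_nonneg (hf0 x)]
    change (‖fn u x‖ ^ 2 - 1) * (Real.smoothTransition (‖fn u x‖ ^ 2 - 1) * ‖fn u x‖ ^ 2)
      ≤ ‖fn u x‖ ^ 4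
    by_cases h : ‖fn u x‖ ^ 2 - 1 ≤ 0
    · rw [Real.smoothTransition.zero_of_nonpos h]
      simp
    · push Not at h
      have h8 := Real.smoothTransition.le_one (‖fn u x‖ ^ 2 - 1)
      calc (‖fn u x‖ ^ 2 - 1) * (Real.smoothTransition (‖fn u x‖ ^ 2 - 1) * ‖fn u x‖ ^ 2)
          ≤ (‖fn u x‖ ^ 2 - 1) * (1 * ‖fn u x‖ ^ 2) := by gcongr
        _ ≤ ‖fn u x‖ ^ 2 * (1 * ‖fn u x‖ ^ 2) := by
            gcongr
            linarith
        _ = _ := by ring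
  filter_upwards [(integral_eq_zero_iff_of_nonneg hf0 hfi).1 h5] with x hx
  by_contra hne
  push Not at hne
  have h6 : 0 < ‖fn u x‖ ^ 2 - 1 := by nlinarith
  have h7 := Real.smoothTransition.pos_of_pos h6
  have h8 : 0 < f x := by
    have : 0 < ‖fn u x‖ := by linarith
    positivity
  exact h8.ne' hx

end MaximumPrinciple


/-! ### Finite dimension of the finite element space. -/

section FiniteElements

variable {d : ℕ} {Ω : Set (E d)}

/-- The weak gradient is determined by the function, by the fundamental lemma of the calculus of
variations. -/
theorem H1.eq_zero_of_fn_ae_eq_zero (hΩ : IsOpen Ω) {v : H1 Ω}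
    (hv : ∀ᵐ x ∂(volume.restrict Ω), fn v x = 0) : v = 0 := by
  have h1 : fn v = 0 := by
    refine Lp.ext ?_
    filter_upwards [hv, Lp.coeFn_zero ℂ 2 (volume.restrict Ω)] with x h1 h2
    rw [h1, h2]
    rfl
  have h2 : ∀ i : Fin d, ∀ᵐ x ∂(volume.restrict Ω), grad v x i = 0 := by
    intro i
    rw [ae_restrict_iff' hΩ.measurableSet]
    refine hΩ.ae_eq_zero_of_integral_contDiff_smul_eq_zero ?_ fun φ hφ hc hs => ?_
    · intro x hx
      obtain ⟨r, hr, hball⟩ := Metric.isOpen_iff.1 hΩ x hx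
      refine ⟨Metric.ball x r ∩ Ω, inter_mem (mem_nhdsWithin_of_mem_nhds (Metric.ball_mem_nhds x hr)) self_mem_nhdsWithin, ?_⟩
      have hm : MemLp (fun x => grad v x i) 2 (volume.restrict (Metric.ball x r ∩ Ω)) :=
        (memLp_coord (grad v) i).mono_measure (Measure.restrict_mono inter_subset_right le_rfl)
      have : IsFiniteMeasure (volume.restrict (Metric.ball x r ∩ Ω)) :=
        ⟨by simpa using (measure_mono inter_subset_left).trans_lt measure_ball_lt_top⟩
      exact hm.integrable one_le_two
    · have h3 := v.2 φ hφ hc hs i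
      have h4 : ∫ x in Ω, ((fderiv ℝ φ x (EuclideanSpace.single i 1) : ℝ) : ℂ) * fn v x = 0 := by
        refine integral_eq_zero_of_ae ?_
        filter_upwards [hv] with x hx
        simp [hx]
      have h5 : ∫ x in Ω, (φ x : ℂ) * grad v x i = 0 := by
        rw [← neg_eq_zero, ← h4]
        exact h3.symm
      rw [← h5, ← setIntegral_eq_integral_of_forall_compl_eq_zero (s := Ω) fun x hx => by
        rw [image_eq_zero_of_notMem_tsupport fun h => hx (hs h), zero_smul]]
      simp
  have h3 : grad v = 0 := by
    refine Lp.ext ?_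
    filter_upwards [ae_all_iff.2 h2,
      Lp.coeFn_zero (EuclideanSpace ℂ (Fin d)) 2 (volume.restrict Ω)] with x h4 h5
    rw [h5]
    ext i
    exact h4 i
  refine Subtype.ext (WithLp.ofLp_injective 2 (Prod.ext h1 h3))

theorem fn_sub (v w : H1 Ω) : fn (v - w) =ᵐ[volume.restrict Ω] fn v - fn w :=
  Lp.coeFn_sub (fn v) (fn w)

/-- Pairs of a finite element function and a family of polynomials representing it. -/
def fePairs (T : CurvedMesh Ω) (p : ℕ) :
    Submodule ℝ (H1 Ω × (T.ι → MvPolynomial.restrictTotalDegree (Fin d) ℂ p)) where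
  carrier := {q | ∀ K : T.ι, ∀ᵐ y ∂(volume.restrict Ω), ∀ x ∈ refSimplex d, T.map K x = y →
    fn q.1 y = MvPolynomial.eval (fun j => (x j : ℂ)) (q.2 K).1}
  zero_mem' := by
    intro K
    filter_upwards [Lp.coeFn_zero ℂ 2 (volume.restrict Ω)] with y hy x _ _
    exact hy.trans (by simp)
  add_mem' := by
    intro a b ha hb K
    filter_upwards [ha K, hb K, Lp.coeFn_add (fn a.1) (fn b.1)] with y h1 h2 h3 x hx hxy
    refine h3.trans ?_
    rw [Pi.add_apply, h1 x hx hxy, h2 x hx hxy]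
    simp
  smul_mem' := by
    intro c a ha K
    filter_upwards [ha K, Lp.coeFn_smul c (fn a.1)] with y h1 h3 x hx hxy
    refine h3.trans ?_
    rw [Pi.smul_apply, h1 x hx hxy, Complex.real_smul]
    change _ = MvPolynomial.eval (fun j => (x j : ℂ)) ((c : ℂ) • (a.2 K).1)
    rw [MvPolynomial.smul_eval]

/-- The representing polynomials are given only by an existence statement, so pairs are used to
avoid a linear choice. The polynomials determine the function because the elements cover `Ω`, hence
the space of pairs embeds into a finite product of polynomial spaces. The finite element space lies
in its image under the first projection. -/
theorem finiteDimensional_feSpace (hΩ : IsOpen Ω) (T : CurvedMesh Ω) (p : ℕ) :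
    FiniteDimensional ℝ (feSpace T p) := by
  have := T.finite_ι
  have hfin : Module.Finite ℝ (MvPolynomial.restrictTotalDegree (Fin d) ℂ p) :=
    Module.Finite.trans ℂ _
  let π : fePairs T p →ₗ[ℝ] (T.ι → MvPolynomial.restrictTotalDegree (Fin d) ℂ p) :=
    (LinearMap.snd ℝ _ _).comp (fePairs T p).subtype
  have hπ : Function.Injective π := by
    intro q q' hqq
    have hq2 : q.1.2 = q'.1.2 := hqq
    refine Subtype.ext (Prod.ext (sub_eq_zero.1 ?_) hq2)
    refine H1.eq_zero_of_fn_ae_eq_zero hΩ ?_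
    filter_upwards [ae_all_iff.2 q.2, ae_all_iff.2 q'.2, fn_sub q.1.1 q'.1.1,
      ae_restrict_mem hΩ.measurableSet] with y hy hy' hs hyΩ
    have hyc : y ∈ ⋃ K, T.map K '' refSimplex d := by
      rw [T.cover]
      exact subset_closure hyΩ
    obtain ⟨K, x, hx, hxy⟩ := mem_iUnion.1 hyc
    rw [hs, Pi.sub_apply, hy K x hx hxy, hy' K x hx hxy, hq2, sub_self]
  have hS : Module.Finite ℝ (fePairs T p) := Module.Finite.of_injective π hπ
  have hle : feSpace T p ≤ (fePairs T p).map (LinearMap.fst ℝ _ _) := by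
    intro v hv
    choose P hP hPv using hv
    exact ⟨(v, fun K => ⟨P K, (MvPolynomial.mem_restrictTotalDegree _ _ _).2 (hP K)⟩), hPv, rfl⟩
  exact Submodule.finiteDimensional_of_le hle

end FiniteElements

/-! ### Bilinearity and symmetry of the second derivative; the Ritz projection. -/

section Forms

variable {d : ℕ} {Ω : Set (E d)} {κ : ℝ} {A : E d → E d}

theorem fn_add (v w : H1 Ω) : fn (v + w) =ᵐ[volume.restrict Ω] fn v + fn w :=
  Lp.coeFn_add (fn v) (fn w)

theorem grad_add (v w : H1 Ω) : grad (v + w) =ᵐ[volume.restrict Ω] grad v + grad w :=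
  Lp.coeFn_add (grad v) (grad w)

theorem fn_smul (c : ℝ) (v : H1 Ω) : fn (c • v) =ᵐ[volume.restrict Ω] c • fn v :=
  Lp.coeFn_smul c (fn v)

theorem grad_smul (c : ℝ) (v : H1 Ω) : grad (c • v) =ᵐ[volume.restrict Ω] c • grad v :=
  Lp.coeFn_smul c (grad v)

theorem memLp_covGrad (hA : MemLp A ⊤ (volume.restrict Ω)) (v : H1 Ω) (j : Fin d) :
    MemLp (fun x => covGrad κ A v x j) 2 (volume.restrict Ω) := by
  have hAj : MemLp (fun x => (A x j : ℂ)) ⊤ (volume.restrict Ω) :=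
    ((Complex.ofRealCLM.comp (EuclideanSpace.proj (𝕜 := ℝ) j)).comp_memLp' hA)
  exact ((memLp_coord (grad v) j).const_mul (Complex.I / (κ : ℂ))).add
    ((Lp.memLp (fn v)).mul (p := ⊤) (q := 2) (r := 2) hAj)

theorem MemLp.integrable_mul_conj {α : Type*} [MeasurableSpace α] {μ : Measure α} {f g : α → ℂ}
    (hf : MemLp f 2 μ) (hg : MemLp g 2 μ) : Integrable (fun x => f x * conj (g x)) μ :=
  hf.integrable_mul hg.star

theorem integrable_covForm (hA : MemLp A ⊤ (volume.restrict Ω)) (v w : H1 Ω) :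
    Integrable (fun x => ∑ j, covGrad κ A v x j * conj (covGrad κ A w x j))
      (volume.restrict Ω) :=
  integrable_finsetSum _ fun j _ =>
    MemLp.integrable_mul_conj (memLp_covGrad hA v j) (memLp_covGrad hA w j)

theorem covForm_add_left (hA : MemLp A ⊤ (volume.restrict Ω)) (v v' w : H1 Ω) :
    covForm κ A (v + v') w = covForm κ A v w + covForm κ A v' w := by
  rw [covForm, covForm, covForm, ← Complex.add_re,
    ← integral_add (integrable_covForm hA v w) (integrable_covForm hA v' w)]
  congr 1
  refine integral_congr_ae ?_
  filter_upwards [fn_add v v', grad_add v v'] with x h1 h2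
  rw [← Finset.sum_add_distrib]
  refine Finset.sum_congr rfl fun j _ => ?_
  simp only [covGrad, h1, h2, Pi.add_apply, PiLp.add_apply]
  ring

theorem covForm_smul_left (c : ℝ) (v w : H1 Ω) :
    covForm κ A (c • v) w = c * covForm κ A v w := by
  rw [covForm, covForm, ← Complex.re_ofReal_mul, ← integral_const_mul]
  congr 1
  refine integral_congr_ae ?_
  filter_upwards [fn_smul c v, grad_smul c v] with x h1 h2
  rw [Finset.mul_sum]
  refine Finset.sum_congr rfl fun j _ => ?_
  simp only [covGrad, h1, h2, Pi.smul_apply, PiLp.smul_apply, Complex.real_smul]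
  ring

theorem covForm_comm (v w : H1 Ω) : covForm κ A v w = covForm κ A w v := by
  rw [covForm, covForm, ← Complex.conj_re, ← integral_conj]
  congr 2
  ext x
  rw [map_sum]
  refine Finset.sum_congr rfl fun j _ => ?_
  rw [map_mul, Complex.conj_conj, mul_comm]

/-- The zeroth order coefficient of the second derivative of the energy, applied to `z`. -/
noncomputable def potential (a z : ℂ) : ℂ := ((2 * ‖a‖ ^ 2 - 1 : ℝ) : ℂ) * z + a ^ 2 * conj z

theorem norm_potential_le {a : ℂ} (ha : ‖a‖ ≤ 1) (z : ℂ) : ‖potential a z‖ ≤ 2 * ‖z‖ := by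
  refine (norm_add_le _ _).trans ?_
  rw [norm_mul, norm_mul, Complex.norm_real, norm_pow, RCLike.norm_conj, two_mul ‖z‖]
  have h1 : ‖a‖ ^ 2 ≤ 1 := pow_le_one₀ (norm_nonneg _) ha
  have h2 : ‖2 * ‖a‖ ^ 2 - 1‖ ≤ 1 := by
    rw [Real.norm_eq_abs, abs_le]
    constructor <;> nlinarith [sq_nonneg ‖a‖]
  exact add_le_add (mul_le_of_le_one_left (norm_nonneg z) h2)
    (mul_le_of_le_one_left (norm_nonneg z) h1)

variable {u : H1 Ω}

/-- The bound `|u| ≤ 1` makes the zeroth order coefficient bounded, so integrability needs only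
`L²`. -/
theorem integrable_potential (hu : ∀ᵐ x ∂(volume.restrict Ω), ‖fn u x‖ ≤ 1) (z w : H1 Ω) :
    Integrable (fun x => potential (fn u x) (fn z x) * conj (fn w x)) (volume.restrict Ω) := by
  refine MemLp.integrable_mul_conj ?_ (Lp.memLp (fn w))
  refine MemLp.of_le_mul (c := 2) (Lp.memLp (fn z)) ?_ ?_
  · have h1 := measurable_fn u
    have h2 := measurable_fn z
    have h3 : Continuous fun q : ℂ × ℂ => potential q.1 q.2 := by
      unfold potential
      fun_prop
    exact (h3.measurable.comp (h1.prodMk h2)).aestronglyMeasurable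
  · filter_upwards [hu] with x hx
    exact norm_potential_le hx _

theorem energyD2_eq (z w : H1 Ω) : energyD2 κ A u z w = covForm κ A z w
    + (∫ x in Ω, potential (fn u x) (fn z x) * conj (fn w x)).re := rfl

theorem energyD2_add_left (hA : MemLp A ⊤ (volume.restrict Ω))
    (hu : ∀ᵐ x ∂(volume.restrict Ω), ‖fn u x‖ ≤ 1) (z z' w : H1 Ω) :
    energyD2 κ A u (z + z') w = energyD2 κ A u z w + energyD2 κ A u z' w := by
  rw [energyD2_eq, energyD2_eq, energyD2_eq, covForm_add_left hA]
  have : ∫ x in Ω, potential (fn u x) (fn (z + z') x) * conj (fn w x)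
      = (∫ x in Ω, potential (fn u x) (fn z x) * conj (fn w x))
        + ∫ x in Ω, potential (fn u x) (fn z' x) * conj (fn w x) := by
    rw [← integral_add (integrable_potential hu z w) (integrable_potential hu z' w)]
    refine integral_congr_ae ?_
    filter_upwards [fn_add z z'] with x h1
    simp only [potential, h1, Pi.add_apply, map_add]
    ring
  rw [this, Complex.add_re]
  ring

theorem energyD2_smul_left (c : ℝ) (z w : H1 Ω) :
    energyD2 κ A u (c • z) w = c * energyD2 κ A u z w := by
  rw [energyD2_eq, energyD2_eq, covForm_smul_left, mul_add]
  congr 1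
  rw [← Complex.re_ofReal_mul, ← integral_const_mul]
  congr 1
  refine integral_congr_ae ?_
  filter_upwards [fn_smul c z] with x h1
  simp only [potential, h1, Pi.smul_apply, Complex.real_smul, map_mul, Complex.conj_ofReal]
  ring

theorem energyD2_comm (hu : ∀ᵐ x ∂(volume.restrict Ω), ‖fn u x‖ ≤ 1) (z w : H1 Ω) :
    energyD2 κ A u z w = energyD2 κ A u w z := by
  rw [energyD2_eq, energyD2_eq, covForm_comm]
  congr 1
  simp only [← RCLike.re_eq_complex_re]
  rw [← integral_re (integrable_potential hu z w), ← integral_re (integrable_potential hu w z)]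
  congr 1
  ext x
  simp only [RCLike.re_eq_complex_re, potential, Complex.mul_re, Complex.add_re, Complex.add_im,
    Complex.mul_im, Complex.conj_re, Complex.conj_im, Complex.ofReal_re, Complex.ofReal_im]
  ring

/-- The second derivative of the energy as a bilinear form. -/
noncomputable def energyForm (κ : ℝ) (hA : MemLp A ⊤ (volume.restrict Ω))
    (hu : ∀ᵐ x ∂(volume.restrict Ω), ‖fn u x‖ ≤ 1) : H1 Ω →ₗ[ℝ] H1 Ω →ₗ[ℝ] ℝ :=
  LinearMap.mk₂ ℝ (energyD2 κ A u) (energyD2_add_left hA hu)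
    (fun c z w => energyD2_smul_left c z w)
    (fun z w w' => by
      rw [energyD2_comm hu, energyD2_add_left hA hu, energyD2_comm hu w, energyD2_comm hu w'])
    (fun c z w => by
      rw [energyD2_comm hu, energyD2_smul_left, energyD2_comm hu w]
      rfl)

/-- The space `(iu)^⊥` as a submodule. -/
def iuPerpSubmodule (u : H1 Ω) : Submodule ℝ (H1 Ω) where
  carrier := iuPerp u
  zero_mem' := by
    change (∫ x in Ω, (Complex.I • fn u) x * conj (fn (0 : H1 Ω) x)).re = 0
    rw [integral_eq_zero_of_ae]
    · simp
    · filter_upwards [Lp.coeFn_zero ℂ 2 (volume.restrict Ω)] with x hx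
      have : fn (0 : H1 Ω) x = 0 := hx
      simp [this]
  add_mem' := by
    intro v w hv hw
    have h1 : ∫ x in Ω, (Complex.I • fn u) x * conj (fn (v + w) x)
        = (∫ x in Ω, (Complex.I • fn u) x * conj (fn v x))
          + ∫ x in Ω, (Complex.I • fn u) x * conj (fn w x) := by
      rw [← integral_add (MemLp.integrable_mul_conj (Lp.memLp _) (Lp.memLp _))
        (MemLp.integrable_mul_conj (Lp.memLp _) (Lp.memLp _))]
      refine integral_congr_ae ?_
      filter_upwards [fn_add v w] with x hx
      rw [hx, Pi.add_apply, map_add, mul_add]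
    change (∫ x in Ω, (Complex.I • fn u) x * conj (fn (v + w) x)).re = 0
    rw [h1, Complex.add_re]
    change l2Inner _ _ + l2Inner _ _ = 0
    rw [hv, hw, add_zero]
  smul_mem' := by
    intro c v hv
    have h1 : ∫ x in Ω, (Complex.I • fn u) x * conj (fn (c • v) x)
        = (c : ℂ) * ∫ x in Ω, (Complex.I • fn u) x * conj (fn v x) := by
      rw [← integral_const_mul]
      refine integral_congr_ae ?_
      filter_upwards [fn_smul c v] with x hx
      rw [hx, Pi.smul_apply, Complex.real_smul, map_mul, Complex.conj_ofReal]
      ring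
    change (∫ x in Ω, (Complex.I • fn u) x * conj (fn (c • v) x)).re = 0
    rw [h1, Complex.re_ofReal_mul]
    change c * l2Inner _ _ = 0
    rw [hv, mul_zero]

/-- A bilinear form that is positive definite on a finite-dimensional subspace represents every
linear functional on that subspace. -/
theorem existsUnique_of_posDef {M : Type*} [AddCommGroup M] [Module ℝ M]
    (B : M →ₗ[ℝ] M →ₗ[ℝ] ℝ) (W : Submodule ℝ M) [FiniteDimensional ℝ W]
    (hB : ∀ w ∈ W, w ≠ 0 → 0 < B w w) (f : M →ₗ[ℝ] ℝ) :
    ∃! r, r ∈ W ∧ ∀ w ∈ W, B r w = f w := by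
  have huniq : ∀ r ∈ W, (∀ w ∈ W, B r w = 0) → r = 0 := fun r hr h => by
    by_contra hne
    exact (hB r hr hne).ne' (h r hr)
  let b : W →ₗ[ℝ] Module.Dual ℝ W := B.domRestrict₁₂ W W
  have hinj : Function.Injective b := by
    rw [← LinearMap.ker_eq_bot, LinearMap.ker_eq_bot']
    intro r hr
    exact Subtype.ext (huniq r r.2 fun w hw => LinearMap.congr_fun hr ⟨w, hw⟩)
  have hsurj : Function.Surjective b :=
    (LinearMap.injective_iff_surjective_of_finrank_eq_finrank
      Subspace.dual_finrank_eq.symm).1 hinj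
  obtain ⟨r, hr⟩ := hsurj (f.domRestrict W)
  refine ⟨r, ⟨r.2, fun w hw => LinearMap.congr_fun hr ⟨w, hw⟩⟩, fun s ⟨hs, hsw⟩ => ?_⟩
  refine sub_eq_zero.1 (huniq _ (W.sub_mem hs r.2) fun w hw => ?_)
  have h1 : B r w = f w := LinearMap.congr_fun hr ⟨w, hw⟩
  rw [map_sub, LinearMap.sub_apply, hsw w hw, h1, sub_self]

theorem existsUnique_isRitzProjection (hΩ : IsOpen Ω) (hA : MemLp A ⊤ (volume.restrict Ω))
    (hu : ∀ᵐ x ∂(volume.restrict Ω), ‖fn u x‖ ≤ 1)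
    (hpos : ∀ v ∈ iuPerp u, v ≠ 0 → 0 < energyD2 κ A u v v) (T : CurvedMesh Ω) (p : ℕ)
    (v : H1 Ω) : ∃! r : H1 Ω, IsRitzProjection κ A u (feSpace T p) v r := by
  have := finiteDimensional_feSpace hΩ T p
  have : FiniteDimensional ℝ (feSpace T p ⊓ iuPerpSubmodule u : Submodule ℝ (H1 Ω)) :=
    Submodule.finiteDimensional_inf_left _ _
  exact existsUnique_of_posDef (energyForm κ hA hu) (feSpace T p ⊓ iuPerpSubmodule u)
    (fun w hw hw0 => hpos w hw.2 hw0) (energyForm κ hA hu v)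

end Forms


/-! ### Taylor remainder of the nonlinearity, its Hölder bounds, and coercivity. -/

section Remainder

variable {d : ℕ} {Ω : Set (E d)} {κ : ℝ} {A : E d → E d}

/-- The terms of order at least two in the expansion of the cubic nonlinearity around `a`. -/
noncomputable def cubicRemainder (a e : ℂ) : ℂ :=
  2 * a * (‖e‖ ^ 2 : ℝ) + conj a * e ^ 2 - (‖e‖ ^ 2 : ℝ) * e

theorem cubicRemainder_eq (a b : ℂ) :
    potential a (a - b) - ((‖a‖ ^ 2 - 1 : ℝ) : ℂ) * a + ((‖b‖ ^ 2 - 1 : ℝ) : ℂ) * b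
      = cubicRemainder a (a - b) := by
  unfold potential cubicRemainder
  push_cast
  simp only [← Complex.mul_conj', map_sub]
  ring

theorem norm_cubicRemainder_le {a : ℂ} (ha : ‖a‖ ≤ 1) (e : ℂ) :
    ‖cubicRemainder a e‖ ≤ 3 * ‖e‖ ^ 2 + ‖e‖ ^ 3 := by
  refine (norm_sub_le _ _).trans (add_le_add ((norm_add_le _ _).trans ?_) ?_)
  · simp only [norm_mul, norm_pow, Complex.norm_real, RCLike.norm_conj, norm_norm,
      RCLike.norm_ofNat]
    nlinarith [sq_nonneg ‖e‖]
  · simp only [norm_mul, norm_pow, Complex.norm_real, norm_norm]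
    exact le_of_eq (by ring)

theorem integrable_cubic (hΩ : IsLipschitzDomain Ω) (hd : d = 2 ∨ d = 3) (v w : H1 Ω) :
    Integrable (fun x => ((‖fn v x‖ ^ 2 - 1 : ℝ) : ℂ) * fn v x * conj (fn w x))
      (volume.restrict Ω) := by
  have h4 : ∀ v : H1 Ω, Integrable (fun x => ‖fn v x‖ ^ 4) (volume.restrict Ω) := fun v =>
    (memLp_four_fn hΩ hd v).integrable_norm_pow (by norm_num)
  have h2 : ∀ v : H1 Ω, Integrable (fun x => ‖fn v x‖ ^ 2) (volume.restrict Ω) := fun v =>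
    (Lp.memLp (fn v)).integrable_norm_pow (by norm_num)
  refine (((h4 v).add (h4 w)).add ((h2 v).add (h2 w))).mono' ?_ (Eventually.of_forall fun x => ?_)
  · have hv := measurable_fn v
    have hw := measurable_fn w
    have hc : Continuous fun q : ℂ × ℂ => ((‖q.1‖ ^ 2 - 1 : ℝ) : ℂ) * q.1 * conj q.2 := by
      fun_prop
    exact (hc.measurable.comp (hv.prodMk hw)).aestronglyMeasurable
  · rw [norm_mul, norm_mul, Complex.norm_real, RCLike.norm_conj]
    set s := ‖fn v x‖
    set t := ‖fn w x‖
    have hs : 0 ≤ s := norm_nonneg _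
    have ht : 0 ≤ t := norm_nonneg _
    have h1 : ‖s ^ 2 - 1‖ ≤ s ^ 2 + 1 := by
      refine (norm_sub_le _ _).trans ?_
      rw [Real.norm_of_nonneg (by positivity), norm_one]
    change _ ≤ s ^ 4 + t ^ 4 + (s ^ 2 + t ^ 2)
    calc ‖s ^ 2 - 1‖ * s * t ≤ (s ^ 2 + 1) * s * t := by gcongr
      _ = s ^ 2 * (s * t) + s * t := by ring
      _ ≤ _ := by
        nlinarith [sq_nonneg (s - t), sq_nonneg (s ^ 2 - s * t), sq_nonneg (s ^ 2 - t ^ 2),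
          sq_nonneg (s + t)]

/-- The covariant part is linear in its first argument, so only the cubic term leaves a remainder,
given pointwise by `cubicRemainder_eq`. -/
theorem energyD2_sub_eq (hΩ : IsLipschitzDomain Ω) (hd : d = 2 ∨ d = 3)
    (hA : MemLp A ⊤ (volume.restrict Ω)) {u : H1 Ω}
    (hu : ∀ᵐ x ∂(volume.restrict Ω), ‖fn u x‖ ≤ 1) (v w : H1 Ω) :
    energyD2 κ A u (u - v) w = energyD1 κ A u w - energyD1 κ A v w
      + (∫ x in Ω, cubicRemainder (fn u x) (fn (u - v) x) * conj (fn w x)).re := by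
  have h1 : covForm κ A (u - v) w = covForm κ A u w - covForm κ A v w := by
    rw [eq_sub_iff_add_eq, ← covForm_add_left hA, sub_add_cancel]
  have h2 : ∫ x in Ω, cubicRemainder (fn u x) (fn (u - v) x) * conj (fn w x)
      = (∫ x in Ω, potential (fn u x) (fn (u - v) x) * conj (fn w x))
        - (∫ x in Ω, ((‖fn u x‖ ^ 2 - 1 : ℝ) : ℂ) * fn u x * conj (fn w x))
        + ∫ x in Ω, ((‖fn v x‖ ^ 2 - 1 : ℝ) : ℂ) * fn v x * conj (fn w x) := by
    rw [← integral_sub (integrable_potential hu _ w) (integrable_cubic hΩ hd u w),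
      ← integral_add (by
        exact (integrable_potential hu _ w).sub (integrable_cubic hΩ hd u w))
        (integrable_cubic hΩ hd v w)]
    refine integral_congr_ae ?_
    filter_upwards [fn_sub u v] with x hx
    simp only [hx, Pi.sub_apply]
    rw [← cubicRemainder_eq]
    ring
  rw [h2, energyD2_eq, h1, energyD1, energyD1, Complex.add_re, Complex.sub_re]
  ring

theorem lintegral_enorm_pow_four (v : H1 Ω) :
    ∫⁻ x in Ω, ‖fn v x‖ₑ ^ 4 = l4Norm v ^ 4 := by
  rw [l4Norm, eLpNorm_eq_lintegral_rpow_enorm_toReal (by simp) (by simp),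
    ← ENNReal.rpow_mul_natCast]
  simp

theorem lintegral_sq_mul_le (e w : H1 Ω) :
    (∫⁻ x in Ω, ‖fn e x‖ₑ ^ 2 * ‖fn w x‖ₑ ^ 2) ≤ l4Norm e ^ 2 * l4Norm w ^ 2 := by
  rw [← ENNReal.pow_le_pow_left_iff (two_ne_zero)]
  have he := (measurable_fn e).enorm
  have hw := (measurable_fn w).enorm
  refine (lintegral_mul_le_of_sq_le (he.pow_const 2).aemeasurable
    (hw.pow_const 2).aemeasurable).trans ?_
  simp only [← pow_mul]
  rw [lintegral_enorm_pow_four, lintegral_enorm_pow_four]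
  exact le_of_eq (by ring)

/-- Hölder with exponents `2, 4, 4`. One factor of `e` is kept in `L²` so that it can be absorbed
into the weighted norm without a power of `κ`. -/
theorem lintegral_quadratic_le (e w : H1 Ω) :
    ∫⁻ x in Ω, ‖fn e x‖ₑ ^ 2 * ‖fn w x‖ₑ ≤ ‖fn e‖ₑ * l4Norm e * l4Norm w := by
  rw [← ENNReal.pow_le_pow_left_iff (two_ne_zero)]
  have he := (measurable_fn e).enorm
  have hw := (measurable_fn w).enorm
  calc (∫⁻ x in Ω, ‖fn e x‖ₑ ^ 2 * ‖fn w x‖ₑ) ^ 2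
      = (∫⁻ x in Ω, ‖fn e x‖ₑ * (‖fn e x‖ₑ * ‖fn w x‖ₑ)) ^ 2 := by
        congr 2
        ext x
        ring
    _ ≤ (∫⁻ x in Ω, ‖fn e x‖ₑ ^ 2) * ∫⁻ x in Ω, (‖fn e x‖ₑ * ‖fn w x‖ₑ) ^ 2 :=
        lintegral_mul_le_of_sq_le he.aemeasurable (he.mul hw).aemeasurable
    _ ≤ ‖fn e‖ₑ ^ 2 * (l4Norm e ^ 2 * l4Norm w ^ 2) := by
        rw [lintegral_enorm_sq_eq]
        gcongr
        simp only [mul_pow]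
        exact lintegral_sq_mul_le e w
    _ = _ := by ring

theorem lintegral_cubic_le (e w : H1 Ω) :
    ∫⁻ x in Ω, ‖fn e x‖ₑ ^ 3 * ‖fn w x‖ₑ ≤ l4Norm e ^ 3 * l4Norm w := by
  rw [← ENNReal.pow_le_pow_left_iff (two_ne_zero)]
  have he := (measurable_fn e).enorm
  have hw := (measurable_fn w).enorm
  calc (∫⁻ x in Ω, ‖fn e x‖ₑ ^ 3 * ‖fn w x‖ₑ) ^ 2
      = (∫⁻ x in Ω, ‖fn e x‖ₑ ^ 2 * (‖fn e x‖ₑ * ‖fn w x‖ₑ)) ^ 2 := by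
        congr 2
        ext x
        ring
    _ ≤ (∫⁻ x in Ω, (‖fn e x‖ₑ ^ 2) ^ 2) * ∫⁻ x in Ω, (‖fn e x‖ₑ * ‖fn w x‖ₑ) ^ 2 :=
        lintegral_mul_le_of_sq_le (he.pow_const 2).aemeasurable (he.mul hw).aemeasurable
    _ ≤ l4Norm e ^ 4 * (l4Norm e ^ 2 * l4Norm w ^ 2) := by
        simp only [← pow_mul]
        rw [lintegral_enorm_pow_four]
        gcongr
        simp only [mul_pow]
        exact lintegral_sq_mul_le e w
    _ = _ := by ring

theorem ofReal_remainder_le {u : H1 Ω} (hu : ∀ᵐ x ∂(volume.restrict Ω), ‖fn u x‖ ≤ 1)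
    (e w : H1 Ω) :
    ENNReal.ofReal (∫ x in Ω, cubicRemainder (fn u x) (fn e x) * conj (fn w x)).re
      ≤ 3 * (‖fn e‖ₑ * l4Norm e * l4Norm w) + l4Norm e ^ 3 * l4Norm w := by
  have he := (measurable_fn e).enorm
  have hw := (measurable_fn w).enorm
  calc ENNReal.ofReal (∫ x in Ω, cubicRemainder (fn u x) (fn e x) * conj (fn w x)).re
      ≤ ‖∫ x in Ω, cubicRemainder (fn u x) (fn e x) * conj (fn w x)‖ₑ := by
        rw [← ofReal_norm]
        exact ENNReal.ofReal_le_ofReal (Complex.re_le_norm _)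
    _ ≤ ∫⁻ x in Ω, ‖cubicRemainder (fn u x) (fn e x) * conj (fn w x)‖ₑ :=
        enorm_integral_le_lintegral_enorm _
    _ ≤ ∫⁻ x in Ω, (3 * (‖fn e x‖ₑ ^ 2 * ‖fn w x‖ₑ) + ‖fn e x‖ₑ ^ 3 * ‖fn w x‖ₑ) := by
        refine lintegral_mono_ae ?_
        filter_upwards [hu] with x hx
        have h1 : ‖cubicRemainder (fn u x) (fn e x) * conj (fn w x)‖
            ≤ 3 * (‖fn e x‖ ^ 2 * ‖fn w x‖) + ‖fn e x‖ ^ 3 * ‖fn w x‖ := by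
          rw [norm_mul, RCLike.norm_conj, ← mul_assoc, ← add_mul]
          exact mul_le_mul_of_nonneg_right (norm_cubicRemainder_le hx _) (norm_nonneg _)
        have h2 := ENNReal.ofReal_le_ofReal h1
        rw [ofReal_norm, ENNReal.ofReal_add (by positivity) (by positivity),
          ENNReal.ofReal_mul (by norm_num), ENNReal.ofReal_mul (by positivity),
          ENNReal.ofReal_mul (by positivity), ENNReal.ofReal_pow (norm_nonneg _),
          ENNReal.ofReal_pow (norm_nonneg _), ofReal_norm, ofReal_norm] at h2
        simpa using h2
    _ = 3 * (∫⁻ x in Ω, ‖fn e x‖ₑ ^ 2 * ‖fn w x‖ₑ)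
          + ∫⁻ x in Ω, ‖fn e x‖ₑ ^ 3 * ‖fn w x‖ₑ := by
        rw [lintegral_add_right _ (by exact (he.pow_const 3).mul hw), lintegral_const_mul' _ _ (by simp)]
    _ ≤ _ := by
        gcongr
        · exact lintegral_quadratic_le e w
        · exact lintegral_cubic_le e w

theorem h1kNorm_pos {κ : ℝ} (hκ : 1 ≤ κ) {v : H1 Ω} (hv : v ≠ 0) : 0 < h1kNorm κ v := by
  have hκ0 : 0 < κ := by linarith
  by_contra hne
  have h0 : h1kNorm κ v = 0 := le_antisymm (not_lt.1 hne) (h1kNorm_nonneg hκ v)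
  unfold h1kNorm at h0
  have h1 : 0 ≤ κ⁻¹ * ‖grad v‖ := by positivity
  have h2 : ‖fn v‖ = 0 := by linarith [norm_nonneg (fn v)]
  have h3 : κ⁻¹ * ‖grad v‖ = 0 := by linarith [norm_nonneg (fn v)]
  have h4 : ‖grad v‖ = 0 := (mul_eq_zero.1 h3).resolve_left (inv_pos.2 hκ0).ne'
  exact hv (Subtype.ext (WithLp.ofLp_injective 2
    (Prod.ext (norm_eq_zero.1 h2) (norm_eq_zero.1 h4))))

/-- The coercivity of the second derivative on `(iu)^⊥`, in terms of `ρ(κ)`. -/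
theorem ofReal_h1kNorm_sq_le {u : H1 Ω} (hκ : 1 ≤ κ)
    (hpos : ∀ v ∈ iuPerp u, v ≠ 0 → 0 < energyD2 κ A u v v) {v : H1 Ω} (hv : v ∈ iuPerp u)
    (hv0 : v ≠ 0) :
    ENNReal.ofReal (h1kNorm κ v) ^ 2 ≤ rho κ A u * ENNReal.ofReal (energyD2 κ A u v v) := by
  have hD := hpos v hv hv0
  have h1 : ENNReal.ofReal (h1kNorm κ v ^ 2 / energyD2 κ A u v v) ≤ rho κ A u :=
    le_iSup₂_of_le v hv (le_iSup_of_le hv0 le_rfl)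
  calc ENNReal.ofReal (h1kNorm κ v) ^ 2
      = ENNReal.ofReal (h1kNorm κ v ^ 2 / energyD2 κ A u v v)
          * ENNReal.ofReal (energyD2 κ A u v v) := by
        rw [← ENNReal.ofReal_pow (h1kNorm_nonneg hκ v), ← ENNReal.ofReal_mul (by positivity),
          div_mul_cancel₀ _ hD.ne']
    _ ≤ _ := by gcongr

end Remainder

end GinzburgLandau

/-! ### The error estimate. -/

theorem mainTheorem10 (d : ℕ) (hd : d = 2 ∨ d = 3) (Ω : Set (GinzburgLandau.E d))
    (hΩ : GinzburgLandau.IsLipschitzDomain Ω) (a : ℝ≥0) :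
    ∃ ηstar C : ℝ, 0 < ηstar ∧ 0 < C ∧
      ∀ (κ : ℝ), 1 ≤ κ →
      ∀ (A : GinzburgLandau.E d → GinzburgLandau.E d), AEStronglyMeasurable A (volume.restrict Ω) →
        eLpNorm A ∞ (volume.restrict Ω) ≤ a →
      ∀ (T : GinzburgLandau.CurvedMesh Ω) (p : ℕ), 1 ≤ p →
      ∀ (u : GinzburgLandau.H1 Ω), GinzburgLandau.IsNondegenerateLocalMin κ A u →
      ∀ (uh : GinzburgLandau.H1 Ω), uh ∈ GinzburgLandau.feSpace T p → uh ∈ GinzburgLandau.iuPerp u →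
        (∀ vh ∈ GinzburgLandau.feSpace T p, GinzburgLandau.energyD1 κ A uh vh = 0) →
        GinzburgLandau.eta κ A u (GinzburgLandau.feSpace T p) ≤ ENNReal.ofReal ηstar →
        (∃! r : GinzburgLandau.H1 Ω, GinzburgLandau.IsRitzProjection κ A u (GinzburgLandau.feSpace T p) u r) ∧
        ∀ r : GinzburgLandau.H1 Ω, GinzburgLandau.IsRitzProjection κ A u (GinzburgLandau.feSpace T p) u r →
          ENNReal.ofReal (GinzburgLandau.h1kNorm κ (r - uh)) ≤
            ENNReal.ofReal C * GinzburgLandau.rho κ A u *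
              (ENNReal.ofReal (κ ^ ((d : ℝ) / 4)) * GinzburgLandau.l4Norm (u - uh) +
                ENNReal.ofReal (κ ^ ((d : ℝ) / 2)) * GinzburgLandau.l4Norm (u - uh) ^ 2) *
              ENNReal.ofReal (GinzburgLandau.h1kNorm κ (u - uh)) := by
  open GinzburgLandau in
  obtain ⟨B, hB⟩ := hΩ.exists_l4Norm_le hd
  -- In the second constant, `3 B` comes from the quadratic part of the remainder and `B²` from the
  -- cubic part, where the embedding is used twice. The summand `1` ensures positivity.
  refine ⟨1, 3 * B + B ^ 2 + 1, one_pos, by positivity, ?_⟩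
  intro κ hκ A hAm hAa T p _ u hu uh huhV huhP huhc _
  have hκ0 : 0 < κ := by linarith
  have hA : MemLp A ⊤ (volume.restrict Ω) := ⟨hAm, hAa.trans_lt ENNReal.coe_lt_top⟩
  have hu1 := norm_fn_le_one hΩ hd hu.first_order
  refine ⟨existsUnique_isRitzProjection hΩ.isOpen hA hu1 hu.second_order T p u, fun r hr => ?_⟩
  set δ := r - uh with hδ
  set e := u - uh with he
  have hδV : δ ∈ feSpace T p := (feSpace T p).sub_mem hr.1.1 huhV
  have hδP : δ ∈ iuPerp u := (iuPerpSubmodule u).sub_mem hr.1.2 huhP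
  by_cases hδ0 : δ = 0
  · have : h1kNorm κ δ = 0 := by
      rw [hδ0, h1kNorm]
      change ‖(0 : L2 Ω)‖ + κ⁻¹ * ‖(0 : L2Vec Ω)‖ = 0
      simp
    rw [this, ENNReal.ofReal_zero]
    exact zero_le
  have hD : energyD2 κ A u δ δ
      = (∫ x in Ω, cubicRemainder (fn u x) (fn e x) * conj (fn δ x)).re := by
    -- Galerkin orthogonality: in the first slot `r` may be replaced by `u`, because `δ` lies in
    -- `V_h ∩ (iu)^⊥`.
    have h1 : energyD2 κ A u δ δ = energyD2 κ A u e δ := by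
      have h2 : ∀ w, energyForm κ hA hu1 r w = energyForm κ hA hu1 u w →
          energyForm κ hA hu1 (r - uh) w = energyForm κ hA hu1 (u - uh) w := fun w hw => by
        rw [map_sub, map_sub, LinearMap.sub_apply, LinearMap.sub_apply, hw]
      exact h2 δ (hr.2 δ ⟨hδV, hδP⟩)
    rw [h1, he, energyD2_sub_eq hΩ hd hA hu1, hu.first_order, huhc δ hδV]
    simp
  have hD' := ofReal_remainder_le hu1 e δ
  rw [← hD] at hD'
  have hcoer := ofReal_h1kNorm_sq_le hκ hu.second_order hδP hδ0
  set X := ENNReal.ofReal (h1kNorm κ δ) with hX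
  set N := ENNReal.ofReal (h1kNorm κ e) with hN
  set k := ENNReal.ofReal (κ ^ ((d : ℝ) / 4)) with hk
  set L := l4Norm e with hL
  have hk2 : ENNReal.ofReal (κ ^ ((d : ℝ) / 2)) = k ^ 2 := by
    rw [hk, ← ENNReal.ofReal_pow (by positivity), ← Real.rpow_mul_natCast hκ0.le]
    congr 2
    push_cast
    ring
  have hX0 : X ≠ 0 := by
    rw [hX, ne_eq, ENNReal.ofReal_eq_zero, not_le]
    exact h1kNorm_pos hκ hδ0
  have hfe : ‖fn e‖ₑ ≤ N := by
    rw [← ofReal_norm, hN]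
    refine ENNReal.ofReal_le_ofReal ?_
    rw [h1kNorm]
    exact le_add_of_nonneg_right (by positivity)
  have hC : ENNReal.ofReal (3 * B + B ^ 2 + 1) = 3 * B + B ^ 2 + 1 := by
    rw [ENNReal.ofReal_add (by positivity) (by norm_num), ENNReal.ofReal_add (by positivity)
      (by positivity), ENNReal.ofReal_mul (by norm_num), ENNReal.ofReal_pow (by positivity)]
    simp
  have hmain : ENNReal.ofReal (energyD2 κ A u δ δ)
      ≤ (3 * B + B ^ 2 + 1) * (k * L + k ^ 2 * L ^ 2) * N * X := by
    calc ENNReal.ofReal (energyD2 κ A u δ δ)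
        ≤ 3 * (‖fn e‖ₑ * L * l4Norm δ) + L ^ 2 * L * l4Norm δ := by
          rw [← pow_succ]
          exact hD'
      -- Of the three `L⁴` factors of `e` in the cubic term, two are kept and one is traded for the
      -- weighted norm of `e`. This yields the second term of the estimate, with `κ^{d/2}`.
      _ ≤ 3 * (N * L * (B * k * X)) + L ^ 2 * (B * k * N) * (B * k * X) := by
          gcongr
          · exact hB κ hκ δ
          · exact hB κ hκ e
          · exact hB κ hκ δ
      _ = (3 * B * (k * L) + B ^ 2 * (k ^ 2 * L ^ 2)) * N * X := by ring
      _ ≤ ((3 * B + B ^ 2 + 1) * (k * L) + (3 * B + B ^ 2 + 1) * (k ^ 2 * L ^ 2)) * N * X := by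
          gcongr
          · rw [add_assoc]
            exact le_self_add
          · rw [add_right_comm]
            exact le_add_self
      _ = _ := by ring
  rw [hk2, hC, ← ENNReal.mul_le_mul_iff_right hX0 ENNReal.ofReal_ne_top]
  calc X * X = X ^ 2 := (sq X).symm
    _ ≤ rho κ A u * ((3 * B + B ^ 2 + 1) * (k * L + k ^ 2 * L ^ 2) * N * X) := by
        refine hcoer.trans ?_
        gcongr
    _ = _ := by ring
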